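/- **Theorem 5.1.** Let $m\ge 2$, let $M^m$ be a smooth (Hausdorff, second countable) manifold, and let $x:M^m\to\mathbb{R}^{m+2}$ be an umbilic-free Wintgen ideal submanifold, that is, a smooth immersion without umbilic points for which equality holds at every point in the DDVV inequality $s+s^{\perp}\le |H|^2$. Here $H=\frac1m\operatorname{tr}\mathrm{II}$ is the mean curvature vector and, for orthonormal tangent and normal frames $e_i$, $\nu_a$, $$s=\tfrac{2}{m(m-1)}\sum_{i<j}\langle R(e_i,e_j)e_j,e_i\rangle,\qquad s^{\perp}=\tfrac{2}{m(m-1)}\Big(\sum_{i<j}\sum_{a<b}\langle R^{\perp}(e_i,e_j)\nu_a,\nu_b\rangle^2\Big)^{1/2}.$$ The mean curvature sphere of $x$ at $p$ is the round $m$-sphere in $\mathbb{R}^{m+2}$ that is tangent to the submanifold at $x(p)$ and has the same mean curvature vector there. It exists exactly at the points with $H(p)\neq 0$ (elsewhere it degenerates to an affine $m$-plane, which has no center); let $c(p)$ denote its center. (1) The centers form an immersed minimal surface: there are a smooth (Hausdorff, second countable) surface $S$ and an immersion $f:S\to\mathbb{R}^{m+2}$ with vanishing mean curvature vector whose image is the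 set $\{c(p): p\in M,\ H(p)\ne0\}$. Moreover, every $p\in M$ with $H(p)\neq0$ has an open neighbourhood $U$ on which $H\ne0$, with a smooth submersion $\pi:U\to S$ such that $c=f\circ\pi$ on $U$. (2) Locally this surface is the real part of a holomorphic isotropic curve: every $p\in M$ with $H(p)\ne0$ has an open neighbourhood $U$ on which $H\neq0$, with a smooth orthonormal frame $\nu_1,\nu_2$ of the normal bundle, a smooth submersion $\zeta$ of $U$ onto an open set $V\subset\mathbb{C}$, and a holomorphic map $F:V\to\mathbb{C}^{m+2}$ with $F'\ne0$ and $\sum_j (F_j')^2=0$ on $V$, such that on $U$ $$F\circ\zeta = x+\frac{\nu_1-i\,\nu_2}{\langle H,\nu_1\rangle-i\,\langle H,\nu_2\rangle},\qquad \operatorname{Re}(F\circ\zeta)=c .$$ -/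

import Mathlib

open scoped Manifold ContDiff

/-- Euclidean `n`-space with its standard inner product. -/
abbrev Euc (n : ℕ) : Type := EuclideanSpace ℝ (Fin n)

namespace Submfd

noncomputable section

/-! ### Geometry of a parametrized submanifold `g : ℝᵏ → ℝⁿ` at a parameter value `y`

All notions are used at parameter values near which `g` is a smooth immersion. -/

/-- The tangent space of the submanifold at `g y`, as a linear subspace of `ℝⁿ`. -/
def tangentSpan {k n : ℕ} (g : Euc k → Euc n) (y : Euc k) : Submodule ℝ (Euc n) :=
  LinearMap.range (fderiv ℝ g y).toLinearMap

/-- Orthogonal projection of `ℝⁿ` onto the tangent space. -/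
def tangentProj {k n : ℕ} (g : Euc k → Euc n) (y : Euc k) : Euc n →L[ℝ] Euc n :=
  (tangentSpan g y).starProjection

/-- Orthogonal projection of `ℝⁿ` onto the normal space. -/
def normalProj {k n : ℕ} (g : Euc k → Euc n) (y : Euc k) : Euc n →L[ℝ] Euc n :=
  (tangentSpan g y)ᗮ.starProjection

/-- The (normal valued) second fundamental form `II(u, v) = (D² g (u, v))^⊥`. -/
def secondFF {k n : ℕ} (g : Euc k → Euc n) (y u v : Euc k) : Euc n :=
  normalProj g y (fderiv ℝ (fderiv ℝ g) y u v)

/-- The matrix of the induced metric in the coordinates given by `g`. -/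
def gram {k n : ℕ} (g : Euc k → Euc n) (y : Euc k) : Matrix (Fin k) (Fin k) ℝ :=
  Matrix.of fun i j =>
    inner ℝ (fderiv ℝ g y (EuclideanSpace.single i 1)) (fderiv ℝ g y (EuclideanSpace.single j 1))

/-- The mean curvature vector `H = (1/k) tr II`, the trace being taken with respect to the
induced metric. -/
def meanCurv {k n : ℕ} (g : Euc k → Euc n) (y : Euc k) : Euc n :=
  (k : ℝ)⁻¹ • ∑ i, ∑ j,
    (gram g y)⁻¹ i j • secondFF g y (EuclideanSpace.single i 1) (EuclideanSpace.single j 1)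

/-- Covariant derivative, in the direction of the constant vector field `u`, of a section `s` of
the subbundle of the trivial `ℝⁿ`-bundle that is the range of the family of orthogonal projections
`P`: differentiate in `ℝⁿ` and project. For the tangent bundle of a submanifold this is the
Levi-Civita connection of the induced metric, for the normal bundle it is the normal connection. -/
def covDeriv {k n : ℕ} (P : Euc k → Euc n →L[ℝ] Euc n) (u : Euc k) (s : Euc k → Euc n)
    (y : Euc k) : Euc n :=
  P y (fderiv ℝ s y u)

/-- The curvature `R(u, v) w = ∇_u ∇_v w - ∇_v ∇_u w` of the connection `covDeriv P`, for the
(commuting) constant vector fields `u`, `v`; the vector `w` in the range of `P y` is extended to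
the section `z ↦ P z w`. -/
def curvature {k n : ℕ} (P : Euc k → Euc n →L[ℝ] Euc n) (u v : Euc k) (w : Euc n)
    (y : Euc k) : Euc n :=
  covDeriv P u (covDeriv P v fun z => P z w) y - covDeriv P v (covDeriv P u fun z => P z w) y

/-- `e` is an orthonormal basis of the parameter space for the induced metric at `y`. -/
def IsTangentFrame {k n : ℕ} (g : Euc k → Euc n) (y : Euc k) (e : Fin k → Euc k) : Prop :=
  Orthonormal ℝ fun i => fderiv ℝ g y (e i)

/-- `ν` is an orthonormal basis of the normal space at `y`. -/
def IsNormalFrame {k c : ℕ} (g : Euc k → Euc (k + c)) (y : Euc k) (ν : Fin c → Euc (k + c)) :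
    Prop :=
  Orthonormal ℝ ν ∧ ∀ a, ν a ∈ (tangentSpan g y)ᗮ

/-- The normalized scalar curvature
`s = 2 / (k (k - 1)) ∑_{i < j} ⟨R(e_i, e_j) e_j, e_i⟩` of the induced metric. -/
def normScalarCurv {k n : ℕ} (g : Euc k → Euc n) (y : Euc k) (e : Fin k → Euc k) : ℝ :=
  2 / ((k : ℝ) * ((k : ℝ) - 1)) * ∑ i, ∑ j ∈ Finset.Ioi i,
    inner ℝ (curvature (tangentProj g) (e i) (e j) (fderiv ℝ g y (e j)) y) (fderiv ℝ g y (e i))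

/-- The normalized scalar normal curvature
`s^⊥ = 2 / (k (k - 1)) (∑_{i < j} ∑_{a < b} ⟨R^⊥(e_i, e_j) ν_a, ν_b⟩²)^{1/2}`. -/
def normNormalCurv {k c : ℕ} (g : Euc k → Euc (k + c)) (y : Euc k) (e : Fin k → Euc k)
    (ν : Fin c → Euc (k + c)) : ℝ :=
  2 / ((k : ℝ) * ((k : ℝ) - 1)) * Real.sqrt (∑ i, ∑ j ∈ Finset.Ioi i, ∑ a, ∑ b ∈ Finset.Ioi a,
    (inner ℝ (curvature (normalProj g) (e i) (e j) (ν a) y) (ν b)) ^ 2)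

/-- Equality holds at `y` in the DDVV inequality `s + s^⊥ ≤ |H|²` for submanifolds of Euclidean
space. (Neither side depends on the choice of the orthonormal frames.) -/
def DDVVEquality {k c : ℕ} (g : Euc k → Euc (k + c)) (y : Euc k) : Prop :=
  ∃ (e : Fin k → Euc k) (ν : Fin c → Euc (k + c)), IsTangentFrame g y e ∧ IsNormalFrame g y ν ∧
    normScalarCurv g y e + normNormalCurv g y e ν = ‖meanCurv g y‖ ^ 2

/-! ### Submanifolds `x : Mᵏ → ℝⁿ` -/

section Manifold

variable (k : ℕ) {n : ℕ} {M : Type*} [TopologicalSpace M] [ChartedSpace (Euc k) M]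

/-- The parametrization of the submanifold `x` by the preferred chart at `p`. -/
def localRep (x : M → Euc n) (p : M) : Euc k → Euc n :=
  x ∘ (extChartAt (𝓡 k) p).symm

/-- The coordinates of `p` in the preferred chart at `p`. -/
def coord (p : M) : Euc k := extChartAt (𝓡 k) p p

/-- Smooth immersions. -/
def IsSmoothImmersion (x : M → Euc n) : Prop :=
  ContMDiff (𝓡 k) (𝓡 n) ∞ x ∧ ∀ p, Function.Injective (mfderiv (𝓡 k) (𝓡 n) x p)

/-- The tangent space of the submanifold at `x p`, as a linear subspace of `ℝⁿ`. -/
def tangentSpace (x : M → Euc n) (p : M) : Submodule ℝ (Euc n) :=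
  tangentSpan (localRep k x p) (coord k p)

/-- The mean curvature vector of the submanifold at `p`. -/
def meanCurvature (x : M → Euc n) (p : M) : Euc n :=
  meanCurv (localRep k x p) (coord k p)

/-- `p` is an umbilic point: `II = ⟨·,·⟩ H` at `p`. -/
def IsUmbilic (x : M → Euc n) (p : M) : Prop :=
  ∀ u v : Euc k, secondFF (localRep k x p) (coord k p) u v =
    (inner ℝ (fderiv ℝ (localRep k x p) (coord k p) u) (fderiv ℝ (localRep k x p) (coord k p) v) : ℝ) •
      meanCurvature k x p

/-- Minimal immersions: immersions whose mean curvature vector vanishes identically. -/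
def IsMinimalImmersion (x : M → Euc n) : Prop :=
  IsSmoothImmersion k x ∧ ∀ p, meanCurvature k x p = 0

/-- Wintgen ideal submanifolds of codimension `c`: immersed submanifolds for which equality holds
in the DDVV inequality at every point. -/
def IsWintgenIdeal {c : ℕ} (x : M → Euc (k + c)) : Prop :=
  IsSmoothImmersion k x ∧ ∀ p, DDVVEquality (localRep k x p) (coord k p)

end Manifold

/-! ### Round spheres and mean curvature spheres -/

/-- A round sphere in `ℝⁿ`: the points of the affine subspace through `center` with direction
`dir` that have distance `radius` from `center`. -/
structure RoundSphere (n : ℕ) where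
  center : Euc n
  radius : ℝ
  radius_pos : 0 < radius
  dir : Submodule ℝ (Euc n)

namespace RoundSphere

variable {n : ℕ}

/-- The points of the sphere. -/
def carrier (S : RoundSphere n) : Set (Euc n) :=
  {z | z - S.center ∈ S.dir ∧ ‖z - S.center‖ = S.radius}

/-- The tangent space of the sphere at one of its points. -/
def tangentAt (S : RoundSphere n) (z : Euc n) : Submodule ℝ (Euc n) :=
  S.dir ⊓ (Submodule.span ℝ {z - S.center})ᗮ

/-- The mean curvature vector of the sphere at one of its points. -/
def meanCurvatureAt (S : RoundSphere n) (z : Euc n) : Euc n :=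
  (S.radius ^ 2)⁻¹ • (S.center - z)

end RoundSphere

section MeanCurvatureSphere

variable (k : ℕ) {n : ℕ} {M : Type*} [TopologicalSpace M] [ChartedSpace (Euc k) M]

/-- `S` is the mean curvature sphere of `x` at `p`: the round sphere tangent to the submanifold at
`x p` with the same mean curvature vector there. (Its dimension is that of the submanifold, as the
tangent spaces agree.) -/
def IsMeanCurvatureSphere (x : M → Euc n) (p : M) (S : RoundSphere n) : Prop :=
  x p ∈ S.carrier ∧ S.tangentAt (x p) = tangentSpace k x p ∧
    S.meanCurvatureAt (x p) = meanCurvature k x p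

/-- `c` is the center of the mean curvature sphere of `x` at `p`. -/
def IsMeanCurvatureCenter (x : M → Euc n) (p : M) (c : Euc n) : Prop :=
  ∃ S : RoundSphere n, IsMeanCurvatureSphere k x p S ∧ S.center = c

/-- The mean curvature vector is normal. -/
theorem meanCurvature_mem_orthogonal (x : M → Euc n) (p : M) :
    meanCurvature k x p ∈ (tangentSpace k x p)ᗮ := by
  unfold meanCurvature meanCurv
  refine Submodule.smul_mem _ _ (Submodule.sum_mem _ fun i _ => Submodule.sum_mem _ fun j _ =>
    Submodule.smul_mem _ _ ?_)
  exact Submodule.starProjection_apply_mem _ _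

/-- The mean curvature sphere exists exactly where `H ≠ 0` (elsewhere it degenerates to the affine
tangent space), and then its center is `x + H / |H|²`. -/
theorem isMeanCurvatureCenter_iff (x : M → Euc n) (p : M) (c : Euc n) :
    IsMeanCurvatureCenter k x p c ↔ meanCurvature k x p ≠ 0 ∧
      c = x p + (‖meanCurvature k x p‖ ^ 2)⁻¹ • meanCurvature k x p := by
  have hT := meanCurvature_mem_orthogonal k x p
  constructor
  · rintro ⟨S, ⟨⟨-, hr⟩, -, hH⟩, rfl⟩
    have hr0 := S.radius_pos
    have hn : ‖meanCurvature k x p‖ = S.radius⁻¹ := by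
      rw [← hH, RoundSphere.meanCurvatureAt, norm_smul, norm_sub_rev, hr, norm_inv, norm_pow,
        Real.norm_of_nonneg hr0.le]
      field_simp
    refine ⟨fun h => ?_, ?_⟩
    · rw [h, norm_zero] at hn
      exact (inv_pos.mpr hr0).ne hn
    · rw [hn, ← hH, RoundSphere.meanCurvatureAt, smul_smul, inv_pow, inv_inv,
        mul_inv_cancel₀ (by positivity), one_smul]
      abel
  · rintro ⟨h0, rfl⟩
    set H := meanCurvature k x p with hHdef
    have hn : 0 < ‖H‖ := norm_pos_iff.mpr h0
    have hsub : x p - (x p + (‖H‖ ^ 2)⁻¹ • H) = -((‖H‖ ^ 2)⁻¹ • H) := by abel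
    refine ⟨⟨x p + (‖H‖ ^ 2)⁻¹ • H, ‖H‖⁻¹, inv_pos.mpr hn,
      tangentSpace k x p ⊔ Submodule.span ℝ {H}⟩, ⟨⟨?_, ?_⟩, ?_, ?_⟩, rfl⟩
    · rw [hsub]
      exact Submodule.neg_mem _ (Submodule.smul_mem _ _
        (Submodule.mem_sup_right (Submodule.mem_span_singleton_self H)))
    · rw [hsub, norm_neg, norm_smul, norm_inv, norm_pow, norm_norm]
      field_simp
    · ext v
      simp only [RoundSphere.tangentAt, hsub, Submodule.mem_inf,
        Submodule.mem_orthogonal_singleton_iff_inner_right, inner_neg_left,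
        real_inner_smul_left, neg_eq_zero, mul_eq_zero, inv_eq_zero, pow_eq_zero_iff,
        ne_eq, OfNat.ofNat_ne_zero, not_false_eq_true, norm_eq_zero, h0, false_or]
      constructor
      · rintro ⟨hv, hin⟩
        obtain ⟨t, ht, w, hw, rfl⟩ := Submodule.mem_sup.mp hv
        obtain ⟨a, rfl⟩ := Submodule.mem_span_singleton.mp hw
        have h1 : inner ℝ H t = 0 := Submodule.inner_left_of_mem_orthogonal ht hT
        rw [inner_add_right, h1, zero_add, real_inner_smul_right, real_inner_self_eq_norm_sq] at hin
        have ha : a = 0 := by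
          rcases mul_eq_zero.mp hin with h | h
          · exact h
          · exact absurd h (by positivity)
        rw [ha, zero_smul, add_zero]
        exact ht
      · intro hv
        exact ⟨Submodule.mem_sup_left hv, Submodule.inner_left_of_mem_orthogonal hv hT⟩
    · simp only [RoundSphere.meanCurvatureAt, add_sub_cancel_left, smul_smul, inv_pow, inv_inv]
      rw [mul_inv_cancel₀ (by positivity), one_smul]

/-- The complex vector `X = x + (ν₀ - i ν₁) / (⟨H, ν₀⟩ - i ⟨H, ν₁⟩)` in `ℂⁿ` at `p`, for an
orthonormal frame `ν` of the normal plane at `p`.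

In the light-cone model, where `⟨·,·⟩` is the Lorentz product of `ℝ^{n+2}` and
`ξ_a = ⟨H, ν_a⟩ ((1 + |x|²)/2, (1 - |x|²)/2, x) + (⟨x, ν_a⟩, -⟨x, ν_a⟩, ν_a)`,
this is the complex stereographic projection from `℘ = (1, -1, 0)`, which is the `ℂⁿ`-component of
`-⟨ξ, ℘⟩⁻¹ ξ`, of the Gauss map `[ξ] = [ξ_0 - i ξ_1]`. -/
def complexCenter (x : M → Euc n) (p : M) (ν : Fin 2 → Euc n) : Fin n → ℂ := fun j =>
  (x p j : ℂ) + ((ν 0 j : ℂ) - Complex.I * (ν 1 j : ℂ)) /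
    (((inner ℝ (meanCurvature k x p) (ν 0) : ℝ) : ℂ) -
      Complex.I * ((inner ℝ (meanCurvature k x p) (ν 1) : ℝ) : ℂ))

end MeanCurvatureSphere

end

end Submfd

/-! Fix an orthonormal normal frame ν₀, ν₁. Let a, b be the traceless parts of its two shape
operators and put C = a - i b. By the Gauss and Ricci equations, equality in the DDVV inequality
becomes |[C, C*]|² = 2|C|⁴ (`DDVVEquality.commutator`). Every square complex matrix satisfies |[C,
C*]|² = 2|C|⁴ - Σ|2×2 minors|² - 2|C²|², the sum running over all ordered index quadruples. Hence
all minors of C vanish and C² = 0 (`minors_eq_zero`). As C is symmetric, this means C = α ⊗ α with α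
isotropic, and α ≠ 0 away from umbilics.

Put N = ν₀ - i ν₁, Λ = ⟨H, ν₀⟩ - i ⟨H, ν₁⟩ and X = x + Λ⁻¹ N. All products below are complex
bilinear. The Weingarten equation gives dX · N = 0 and dX(u) · dx(w) = -Λ⁻¹ C(u, w), because the
factor Λ⁻¹ cancels the trace part. So the normal part of dX is a multiple of N, and its tangential
part has complex rank one. The Codazzi equation, in the guise of the symmetry of D²X, makes the
normal coefficient proportional to the same form (`normal_component_symm`). Therefore dX = φ ⊗ ξ
with ξ isotropic. The form φ maps onto ℂ, since the real and imaginary parts of a nonzero isotropic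
form are orthogonal and of equal length.

A component of X, up to a constant, is then locally a submersion ζ to ℂ, and X = F ∘ ζ with F' a
multiple of ξ. So F is holomorphic and isotropic (`exists_holomorphic_factorization`). The real part
of Λ⁻¹ N is H / |H|², hence Re X is the center. The real part of an isotropic holomorphic curve is
conformal and harmonic, hence minimal (`meanCurv_realSurface`). By the Lindelöf property countably
many such pieces cover the set H ≠ 0. Their disjoint union, realized as an open subset of the plane
by translating the parameter domains (`exists_disjoint_translates`), is the surface S. -/

open scoped Matrix

/-! ### Matrices with extremal commutator -/

section Commutator

open Matrix Complex

/-- Two identities carry this. Cyclicity of the trace gives |[C, C*]|² = 2|CC*|² - 2|C²|², and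
expanding the minors gives Σ|minors|² = 2|C|⁴ - 2|CC*|². Under the hypothesis their sum leaves
Σ|minors|² + 2|C²|² = 0. -/
theorem minors_eq_zero {ι : Type*} [Fintype ι] [DecidableEq ι] (C : Matrix ι ι ℂ)
    (h : ∑ i, ∑ j, normSq ((C * Cᴴ - Cᴴ * C) i j) = 2 * (∑ i, ∑ j, normSq (C i j)) ^ 2) :
    (∀ i j k l, C i k * C j l = C i l * C j k) ∧ C * C = 0 := by
  have tr (D : Matrix ι ι ℂ) : (D * Dᴴ).trace = ((∑ i, ∑ j, normSq (D i j) : ℝ) : ℂ) := by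
    simp [Matrix.trace, Matrix.mul_apply, Complex.mul_conj]
  have h1 : (∑ i, ∑ j, normSq ((C * Cᴴ - Cᴴ * C) i j)) =
      2 * (∑ i, ∑ j, normSq ((C * Cᴴ) i j)) - 2 * (∑ i, ∑ j, normSq ((C * C) i j)) := by
    apply Complex.ofReal_injective
    push_cast [← tr]
    have e1 : (Cᴴ * C * (Cᴴ * C)).trace = (C * Cᴴ * (C * Cᴴ)).trace := by
      rw [Matrix.mul_assoc, Matrix.trace_mul_comm]; simp only [Matrix.mul_assoc]
    have e2 : (C * Cᴴ * (Cᴴ * C)).trace = (C * C * (Cᴴ * Cᴴ)).trace := by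
      rw [← Matrix.mul_assoc, Matrix.trace_mul_comm]; simp only [Matrix.mul_assoc]
    have e3 : (Cᴴ * C * (C * Cᴴ)).trace = (C * C * (Cᴴ * Cᴴ)).trace := by
      rw [Matrix.trace_mul_comm, e2]
    have t := tr (C * Cᴴ - Cᴴ * C)
    have t2 := tr (C * Cᴴ)
    have t3 := tr (C * C)
    push_cast at t t2 t3
    simp only [conjTranspose_sub, conjTranspose_mul, conjTranspose_conjTranspose, sub_mul, mul_sub,
      trace_sub, e1, e2, e3]
    ring
  have h2 : ∑ i, ∑ j, ∑ k, ∑ l, normSq (C i k * C j l - C i l * C j k) =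
      2 * (∑ i, ∑ j, normSq (C i j)) ^ 2 - 2 * (∑ i, ∑ j, normSq ((C * Cᴴ) i j)) := by
    apply Complex.ofReal_injective
    have t (i j) : ∑ k, ∑ l, (normSq (C i k * C j l - C i l * C j k) : ℂ) =
        2 * ((∑ k, (normSq (C i k) : ℂ)) * ∑ l, (normSq (C j l) : ℂ)) -
          2 * (normSq ((C * Cᴴ) i j) : ℂ) := by
      simp only [← Complex.mul_conj, mul_apply, conjTranspose_apply, map_sum, map_mul, map_sub,
        Finset.sum_mul_sum, RCLike.star_def, Complex.conj_conj]
      have e1 : ∑ k, ∑ l, C i l * (starRingEnd ℂ) (C i l) * (C j k * (starRingEnd ℂ) (C j k)) =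
        ∑ k, ∑ l, C i k * (starRingEnd ℂ) (C i k) * (C j l * (starRingEnd ℂ) (C j l)) :=
        Finset.sum_comm
      have e2 : ∑ k, ∑ l, C i l * (starRingEnd ℂ) (C j l) * ((starRingEnd ℂ) (C i k) * C j k) =
        ∑ k, ∑ l, C i k * (starRingEnd ℂ) (C j k) * ((starRingEnd ℂ) (C i l) * C j l) :=
        Finset.sum_comm
      rw [two_mul, two_mul]
      nth_rw 2 [← e1]
      nth_rw 2 [← e2]
      simp only [← Finset.sum_add_distrib, ← Finset.sum_sub_distrib]
      refine Finset.sum_congr rfl fun k _ => Finset.sum_congr rfl fun l _ => ?_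
      ring
    push_cast
    simp only [t, Finset.sum_sub_distrib, ← Finset.mul_sum]
    rw [← Finset.sum_mul, sq]
  have h3 : (∑ i, ∑ j, ∑ k, ∑ l, normSq (C i k * C j l - C i l * C j k)) +
      2 * (∑ i, ∑ j, normSq ((C * C) i j)) = 0 := by linarith
  have n1 (i j k l) : 0 ≤ normSq (C i k * C j l - C i l * C j k) := Complex.normSq_nonneg _
  have n2 (i j) : 0 ≤ normSq ((C * C) i j) := Complex.normSq_nonneg _
  have p1 : 0 ≤ ∑ i, ∑ j, ∑ k, ∑ l, normSq (C i k * C j l - C i l * C j k) :=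
    Finset.sum_nonneg fun i _ => Finset.sum_nonneg fun j _ => Finset.sum_nonneg fun k _ =>
      Finset.sum_nonneg fun l _ => n1 i j k l
  have p2 : 0 ≤ ∑ i, ∑ j, normSq ((C * C) i j) :=
    Finset.sum_nonneg fun i _ => Finset.sum_nonneg fun j _ => n2 i j
  constructor
  · intro i j k l
    have z : ∑ i, ∑ j, ∑ k, ∑ l, normSq (C i k * C j l - C i l * C j k) = 0 := by linarith
    have z := (Finset.sum_eq_zero_iff_of_nonneg fun i _ => Finset.sum_nonneg fun j _ =>
      Finset.sum_nonneg fun k _ => Finset.sum_nonneg fun l _ => n1 i j k l).mp z i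
        (Finset.mem_univ _)
    have z := (Finset.sum_eq_zero_iff_of_nonneg fun j _ => Finset.sum_nonneg fun k _ =>
      Finset.sum_nonneg fun l _ => n1 i j k l).mp z j (Finset.mem_univ _)
    have z := (Finset.sum_eq_zero_iff_of_nonneg fun k _ => Finset.sum_nonneg fun l _ =>
      n1 i j k l).mp z k (Finset.mem_univ _)
    have z := (Finset.sum_eq_zero_iff_of_nonneg fun l _ => n1 i j k l).mp z l (Finset.mem_univ _)
    exact sub_eq_zero.mp (Complex.normSq_eq_zero.mp z)
  · ext i j
    have z : ∑ i, ∑ j, normSq ((C * C) i j) = 0 := by linarith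
    have z := (Finset.sum_eq_zero_iff_of_nonneg fun i _ => Finset.sum_nonneg fun j _ =>
      n2 i j).mp z i (Finset.mem_univ _)
    have z := (Finset.sum_eq_zero_iff_of_nonneg fun j _ => n2 i j).mp z j (Finset.mem_univ _)
    exact Complex.normSq_eq_zero.mp z

/-- Two real symmetric matrices with the largest possible commutator: the complex matrix that they
form has rank at most one and square zero. -/
theorem minors_eq_zero_of_commutator {ι : Type*} [Fintype ι] [DecidableEq ι] (a b : Matrix ι ι ℝ)
    (ha : ∀ i j, a i j = a j i) (hb : ∀ i j, b i j = b j i)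
    (h : 2 * ∑ i, ∑ j, (∑ k, (a i k * b j k - b i k * a j k)) ^ 2 =
      (∑ i, ∑ j, (a i j ^ 2 + b i j ^ 2)) ^ 2) :
    (∀ i j k l, ((a i k : ℂ) - I * b i k) * (a j l - I * b j l) =
      (a i l - I * b i l) * (a j k - I * b j k)) ∧
    ∀ i j, ∑ k, ((a i k : ℂ) - I * b i k) * (a j k - I * b j k) = 0 := by
  set C : Matrix ι ι ℂ := Matrix.of fun i j => (a i j : ℂ) - I * b i j with hC
  have hCij (i j) : C i j = (a i j : ℂ) - I * b i j := rfl
  -- By symmetry Cᴴ = a + i b, so the commutator equals 2i(ab - ba).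
  have e1 (i j) : normSq ((C * Cᴴ - Cᴴ * C) i j) =
      4 * (∑ k, (a i k * b j k - b i k * a j k)) ^ 2 := by
    have : (C * Cᴴ - Cᴴ * C) i j = 2 * I * ((∑ k, (a i k * b j k - b i k * a j k) : ℝ) : ℂ) := by
      simp only [Matrix.sub_apply, Matrix.mul_apply, Matrix.conjTranspose_apply, hCij,
        ← Finset.sum_sub_distrib, RCLike.star_def, map_sub, map_mul, Complex.conj_ofReal,
        Complex.conj_I, Complex.ofReal_sum, Finset.mul_sum, Complex.ofReal_sub, Complex.ofReal_mul]
      refine Finset.sum_congr rfl fun k _ => ?_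
      rw [ha k j, hb k j, ha k i, hb k i]
      ring
    rw [this, normSq_mul, normSq_mul, normSq_ofReal, normSq_I, ← sq]
    norm_num [normSq_apply]
  have e2 (i j) : normSq (C i j) = a i j ^ 2 + b i j ^ 2 := by
    rw [hCij, normSq_apply]
    simp
    ring
  have := minors_eq_zero C (by
    simp only [e1, e2, ← Finset.mul_sum]
    linarith)
  refine ⟨this.1, fun i j => ?_⟩
  have h2 := congrFun (congrFun this.2 i) j
  rw [Matrix.mul_apply] at h2
  simp only [← hCij]
  rw [← Matrix.zero_apply i j, ← h2]
  exact Finset.sum_congr rfl fun k _ => by rw [hCij j k, hCij k j, ha j k, hb j k]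

end Commutator

namespace Submfd

/-! ### Derivatives of families of linear maps -/

section ApplyDerivatives

variable {E F G : Type*} [NormedAddCommGroup E] [NormedSpace ℝ E] [NormedAddCommGroup F]
  [NormedSpace ℝ F] [NormedAddCommGroup G] [NormedSpace ℝ G]

theorem fderiv_clm_apply_apply {c : E → F →L[ℝ] G} {w : E → F} {y : E}
    (hc : DifferentiableAt ℝ c y) (hw : DifferentiableAt ℝ w y) (u : E) :
    fderiv ℝ (fun z => c z (w z)) y u = c y (fderiv ℝ w y u) + fderiv ℝ c y u (w y) := by
  rw [fderiv_clm_apply hc hw]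
  rfl

theorem fderiv_clm_apply_const {c : E → F →L[ℝ] G} {y : E} (hc : DifferentiableAt ℝ c y) (u : E)
    (w : F) : fderiv ℝ (fun z => c z w) y u = fderiv ℝ c y u w := by
  rw [fderiv_clm_apply_apply hc (differentiableAt_const w), fderiv_fun_const]
  exact (congrArg (· + fderiv ℝ c y u w) (map_zero (c y))).trans (zero_add _)

theorem two_le_infty : (2 : ℕ∞ω) ≤ ∞ := by
  exact WithTop.coe_le_coe.mpr (le_top : (2 : ℕ∞) ≤ ⊤)

end ApplyDerivatives

/-! ### Smooth projections and the structure equations -/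

section Geometry

variable {k n : ℕ} {g : Euc k → Euc n} {y : Euc k}

theorem apply_eq_sum_single {F : Type*} [AddCommGroup F] [Module ℝ F] (L : Euc k →ₗ[ℝ] F)
    (v : Euc k) : L v = ∑ i, v i • L (EuclideanSpace.single i 1) := by
  conv_lhs => rw [← (EuclideanSpace.basisFun (Fin k) ℝ).sum_repr v]
  simp

theorem gram_det_ne_zero (h : Function.Injective (fderiv ℝ g y)) : (gram g y).det ≠ 0 := by
  intro h0
  obtain ⟨v, hv, hv0⟩ := Matrix.exists_mulVec_eq_zero_iff.mpr h0
  apply hv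
  have e : fderiv ℝ g y (WithLp.toLp 2 v) = ∑ i, v i • fderiv ℝ g y (EuclideanSpace.single i 1) :=
    apply_eq_sum_single (fderiv ℝ g y).toLinearMap _
  have : inner ℝ (fderiv ℝ g y (WithLp.toLp 2 v)) (fderiv ℝ g y (WithLp.toLp 2 v)) = (0 : ℝ) := by
    rw [e, sum_inner]
    refine Finset.sum_eq_zero fun i _ => ?_
    have := congrFun hv0 i
    simp only [Matrix.mulVec, dotProduct, gram, Matrix.of_apply, Pi.zero_apply] at this
    rw [real_inner_smul_left, inner_sum]
    simp only [real_inner_smul_right]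
    rw [← mul_zero (v i), ← this]
    congr 1
    exact Finset.sum_congr rfl fun j _ => mul_comm _ _
  have h1 : WithLp.toLp 2 v = (0 : Euc k) := h (by rw [inner_self_eq_zero.mp this, map_zero])
  funext i
  exact congrArg (fun w : Euc k => w i) h1

theorem contDiffAt_fderiv (hg : ContDiffAt ℝ ∞ g y) : ContDiffAt ℝ ∞ (fderiv ℝ g) y :=
  hg.fderiv_right (by simp)

theorem contDiffAt_fderiv_apply (hg : ContDiffAt ℝ ∞ g y) (v : Euc k) :
    ContDiffAt ℝ ∞ (fun z => fderiv ℝ g z v) y :=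
  (contDiffAt_fderiv hg).clm_apply contDiffAt_const

theorem contDiffAt_gram (hg : ContDiffAt ℝ ∞ g y) (i j : Fin k) :
    ContDiffAt ℝ ∞ (fun z => gram g z i j) y :=
  (contDiffAt_fderiv_apply hg _).inner ℝ (contDiffAt_fderiv_apply hg _)

theorem contDiffAt_det {A : Euc k → Matrix (Fin n) (Fin n) ℝ}
    (hA : ∀ i j, ContDiffAt ℝ ∞ (fun z => A z i j) y) : ContDiffAt ℝ ∞ (fun z => (A z).det) y := by
  simp only [Matrix.det_apply]
  exact ContDiffAt.sum fun σ _ => (contDiffAt_prod fun i _ => hA _ _).const_smul _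

/-- Cramer's rule: the entries of the inverse are quotients of determinants. -/
theorem contDiffAt_matrix_inv {A : Euc k → Matrix (Fin n) (Fin n) ℝ}
    (hA : ∀ i j, ContDiffAt ℝ ∞ (fun z => A z i j) y) (h0 : (A y).det ≠ 0) (i j : Fin n) :
    ContDiffAt ℝ ∞ (fun z => (A z)⁻¹ i j) y := by
  simp only [Matrix.inv_def, Matrix.smul_apply, Matrix.adjugate_apply, Ring.inverse_eq_inv]
  refine ((contDiffAt_det hA).inv h0).smul (contDiffAt_det fun a b => ?_)
  by_cases h : a = j
  · subst h; simpa using contDiffAt_const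
  · simpa [Matrix.updateRow_ne h] using hA a b

theorem contDiffAt_gram_inv (hg : ContDiffAt ℝ ∞ g y) (h : Function.Injective (fderiv ℝ g y))
    (i j : Fin k) : ContDiffAt ℝ ∞ (fun z => (gram g z)⁻¹ i j) y :=
  contDiffAt_matrix_inv (contDiffAt_gram hg) (gram_det_ne_zero h) i j

theorem injective_of_gram_det_ne_zero (h : (gram g y).det ≠ 0) :
    Function.Injective (fderiv ℝ g y) := by
  refine (injective_iff_map_eq_zero (fderiv ℝ g y)).mpr fun v hv => ?_
  have e : ∑ i, v i • fderiv ℝ g y (EuclideanSpace.single i 1) = 0 := by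
    rw [← hv]; exact (apply_eq_sum_single (fderiv ℝ g y).toLinearMap _).symm
  have : (gram g y).mulVec (fun i => v i) = 0 := by
    funext i
    have := congrArg (fun w => inner ℝ (fderiv ℝ g y (EuclideanSpace.single i 1)) w) e
    simp only [inner_sum, real_inner_smul_right, inner_zero_right] at this
    simp only [Matrix.mulVec, dotProduct, gram, Matrix.of_apply, Pi.zero_apply]
    rw [← this]
    exact Finset.sum_congr rfl fun j _ => mul_comm _ _
  have := Matrix.eq_zero_of_mulVec_eq_zero h this
  ext i
  exact congrFun this i

/-- Being an immersion is an open condition because it is the nonvanishing of the continuous Gram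
determinant. -/
theorem eventually_injective (hg : ContDiffAt ℝ ∞ g y) (h : Function.Injective (fderiv ℝ g y)) :
    ∀ᶠ z in nhds y, Function.Injective (fderiv ℝ g z) := by
  have h1 : ∀ᶠ z in nhds y, (gram g z).det ≠ 0 :=
    (contDiffAt_det (contDiffAt_gram hg)).continuousAt.eventually_ne (gram_det_ne_zero h)
  filter_upwards [h1] with z a
  exact injective_of_gram_det_ne_zero a

theorem fderiv_mem_tangentSpan (v : Euc k) : fderiv ℝ g y v ∈ tangentSpan g y :=
  ⟨v, rfl⟩

theorem tangentProj_fderiv (v : Euc k) : tangentProj g y (fderiv ℝ g y v) = fderiv ℝ g y v :=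
  Submodule.starProjection_eq_self_iff.mpr (fderiv_mem_tangentSpan v)

theorem tangentProj_mem (w : Euc n) : tangentProj g y w ∈ tangentSpan g y :=
  Submodule.starProjection_apply_mem _ _

theorem normalProj_mem (w : Euc n) : normalProj g y w ∈ (tangentSpan g y)ᗮ :=
  Submodule.starProjection_apply_mem _ _

theorem normalProj_eq : normalProj g y = ContinuousLinearMap.id ℝ (Euc n) - tangentProj g y :=
  Submodule.starProjection_orthogonal (tangentSpan g y)

theorem tangentProj_eq_zero {ν : Euc n} (hν : ν ∈ (tangentSpan g y)ᗮ) : tangentProj g y ν = 0 :=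
  Submodule.starProjection_apply_eq_zero_iff (K := tangentSpan g y) |>.mpr hν

theorem normalProj_eq_self {ν : Euc n} (hν : ν ∈ (tangentSpan g y)ᗮ) : normalProj g y ν = ν :=
  Submodule.starProjection_eq_self_iff.mpr hν

theorem inner_tangentProj (v w : Euc n) :
    inner ℝ (tangentProj g y v) w = inner ℝ v (tangentProj g y w) :=
  Submodule.inner_starProjection_left_eq_right (tangentSpan g y) _ _

/-- This expression by the inverse Gram matrix makes the smooth dependence of the projection on the
point visible. -/
theorem tangentProj_eq_sum (h : Function.Injective (fderiv ℝ g y)) :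
    tangentProj g y = ∑ i, ∑ j, (gram g y)⁻¹ i j •
      (innerSL ℝ (fderiv ℝ g y (EuclideanSpace.single j 1))).smulRight
        (fderiv ℝ g y (EuclideanSpace.single i 1)) := by
  ext1 w
  refine Submodule.eq_starProjection_of_mem_orthogonal (K := tangentSpan g y) ?_ ?_
  · simp only [sum_apply, smul_apply,
      ContinuousLinearMap.smulRight_apply]
    exact Submodule.sum_mem _ fun i _ => Submodule.sum_mem _ fun j _ => Submodule.smul_mem _ _
      (Submodule.smul_mem _ _ (fderiv_mem_tangentSpan _))
  · rw [Submodule.mem_orthogonal]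
    rintro _ ⟨v, rfl⟩
    change inner ℝ (fderiv ℝ g y v) _ = 0
    have e : fderiv ℝ g y v = ∑ i, v i • fderiv ℝ g y (EuclideanSpace.single i 1) :=
      apply_eq_sum_single (fderiv ℝ g y).toLinearMap _
    rw [e, sum_inner]
    refine Finset.sum_eq_zero fun l _ => ?_
    rw [real_inner_smul_left]
    convert mul_zero _
    rw [inner_sub_right, sub_eq_zero]
    simp only [sum_apply, smul_apply,
      ContinuousLinearMap.smulRight_apply, inner_sum, real_inner_smul_right, innerSL_apply_apply]
    have hG : gram g y * (gram g y)⁻¹ = 1 :=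
      Matrix.mul_nonsing_inv _ (isUnit_iff_ne_zero.mpr (gram_det_ne_zero h))
    rw [Finset.sum_comm]
    have : ∀ j, ∑ i, (gram g y)⁻¹ i j * (inner ℝ (fderiv ℝ g y (EuclideanSpace.single j 1)) w *
        inner ℝ (fderiv ℝ g y (EuclideanSpace.single l 1))
          (fderiv ℝ g y (EuclideanSpace.single i 1))) =
        (1 : Matrix (Fin k) (Fin k) ℝ) l j *
          inner ℝ (fderiv ℝ g y (EuclideanSpace.single j 1)) w := by
      intro j
      rw [← hG, Matrix.mul_apply, Finset.sum_mul]
      refine Finset.sum_congr rfl fun i _ => ?_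
      simp only [gram, Matrix.of_apply]
      ring
    simp [this, Matrix.one_apply]

theorem contDiffAt_tangentProj (hg : ContDiffAt ℝ ∞ g y) (h : Function.Injective (fderiv ℝ g y)) :
    ContDiffAt ℝ ∞ (tangentProj g) y := by
  have : tangentProj g =ᶠ[nhds y] fun z => ∑ i, ∑ j, (gram g z)⁻¹ i j •
      (innerSL ℝ (fderiv ℝ g z (EuclideanSpace.single j 1))).smulRight
        (fderiv ℝ g z (EuclideanSpace.single i 1)) := by
    filter_upwards [eventually_injective hg h] with z hz
    exact tangentProj_eq_sum hz
  refine ContDiffAt.congr_of_eventuallyEq ?_ this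
  refine ContDiffAt.sum fun i _ => ContDiffAt.sum fun j _ =>
    (contDiffAt_gram_inv hg h i j).smul ?_
  exact ((innerSL ℝ (E := Euc n)).contDiff.contDiffAt.comp y
    (contDiffAt_fderiv_apply hg _)).smulRight (contDiffAt_fderiv_apply hg _)

theorem fderiv_normalProj (v : Euc k) :
    fderiv ℝ (normalProj g) y v = - fderiv ℝ (tangentProj g) y v := by
  have : normalProj g = fun z => ContinuousLinearMap.id ℝ (Euc n) - tangentProj g z := by
    funext z; exact normalProj_eq
  rw [this, fderiv_const_sub]
  rfl

/-- Differentiating P(dg w) = dg w gives dP(v)(dg w) = (1 - P) D²g(v, w). Thus dP on tangent vectors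
is the second fundamental form; by self-adjointness, dP on normal vectors is the shape operator. -/
theorem fderiv_tangentProj_fderiv (hg : ContDiffAt ℝ ∞ g y)
    (h : Function.Injective (fderiv ℝ g y)) (v w : Euc k) :
    fderiv ℝ (tangentProj g) y v (fderiv ℝ g y w) = secondFF g y v w := by
  have hP := (contDiffAt_tangentProj hg h).differentiableAt (by simp)
  have hd := (contDiffAt_fderiv hg).differentiableAt (by simp)
  have e : (fun z => tangentProj g z (fderiv ℝ g z w)) = fun z => fderiv ℝ g z w := by
    funext z; exact tangentProj_fderiv w
  have h1 := fderiv_clm_apply_apply hP (hd.clm_apply (differentiableAt_const w)) v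
  rw [e, fderiv_clm_apply_const hd] at h1
  rw [secondFF, normalProj_eq]
  exact (sub_eq_iff_eq_add'.mpr h1).symm

theorem inner_fderiv_tangentProj (hP : DifferentiableAt ℝ (tangentProj g) y) (u : Euc k)
    (v w : Euc n) : inner ℝ (fderiv ℝ (tangentProj g) y u v) w =
      inner ℝ v (fderiv ℝ (tangentProj g) y u w) := by
  have e : (fun z => inner ℝ (tangentProj g z v) w) = fun z => inner ℝ v (tangentProj g z w) := by
    funext z; exact inner_tangentProj v w
  have h1 := congrArg (fun f => fderiv ℝ f y u) e
  rw [fderiv_inner_apply ℝ (hP.clm_apply (differentiableAt_const v)) (differentiableAt_const w),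
    fderiv_inner_apply ℝ (differentiableAt_const v) (hP.clm_apply (differentiableAt_const w)),
    fderiv_clm_apply_const hP, fderiv_clm_apply_const hP, fderiv_fun_const, fderiv_fun_const] at h1
  simpa only [Pi.zero_apply, zero_apply, inner_zero_left, inner_zero_right,
    zero_add, add_zero] using h1

/-- Differentiate P² = P and use Pν = 0. -/
theorem tangentProj_fderiv_tangentProj (hP : DifferentiableAt ℝ (tangentProj g) y) (u : Euc k)
    {ν : Euc n} (hν : ν ∈ (tangentSpan g y)ᗮ) :
    tangentProj g y (fderiv ℝ (tangentProj g) y u ν) = fderiv ℝ (tangentProj g) y u ν := by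
  have e : (fun z => tangentProj g z (tangentProj g z ν)) = fun z => tangentProj g z ν := by
    funext z; exact Submodule.starProjection_eq_self_iff.mpr (tangentProj_mem ν)
  have h1 := congrArg (fun f => fderiv ℝ f y u) e
  rwa [fderiv_clm_apply_apply hP (hP.clm_apply (differentiableAt_const ν)),
    fderiv_clm_apply_const hP, tangentProj_eq_zero hν, map_zero, add_zero] at h1

/-- The terms with second derivatives of P are symmetric in u and v and cancel. What remains is
P[dP(u), dP(v)], from which the Gauss and Ricci equations are read off. -/
theorem curvature_eq {P : Euc k → Euc n →L[ℝ] Euc n} (hP : ContDiffAt ℝ ∞ P y) (u v : Euc k)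
    (w : Euc n) : curvature P u v w y =
      P y (fderiv ℝ P y u (fderiv ℝ P y v w)) - P y (fderiv ℝ P y v (fderiv ℝ P y u w)) := by
  have hd : ∀ᶠ z in nhds y, DifferentiableAt ℝ P z :=
    ((hP.of_le two_le_infty).eventually (by decide)).mono fun z hz =>
      hz.differentiableAt (by simp)
  have hP0 : DifferentiableAt ℝ P y := hP.differentiableAt (by simp)
  have hP2 : DifferentiableAt ℝ (fderiv ℝ P) y :=
    (hP.fderiv_right (m := ∞) (by simp)).differentiableAt (by simp)
  have key (u v : Euc k) : covDeriv P u (covDeriv P v fun z => P z w) y =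
      P y (fderiv ℝ P y u (fderiv ℝ P y v w)) +
        P y (P y (fderiv ℝ (fderiv ℝ P) y u v w)) := by
    have e : covDeriv P v (fun z => P z w) =ᶠ[nhds y] fun z => P z (fderiv ℝ P z v w) := by
      filter_upwards [hd] with z hz
      rw [covDeriv, fderiv_clm_apply_const hz]
    have d1 : DifferentiableAt ℝ (fun z => fderiv ℝ P z v) y :=
      hP2.clm_apply (differentiableAt_const v)
    rw [covDeriv, e.fderiv_eq, fderiv_clm_apply_apply hP0
      (d1.clm_apply (differentiableAt_const w)), fderiv_clm_apply_const d1,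
      fderiv_clm_apply_const hP2, map_add, add_comm]
  have hs : fderiv ℝ (fderiv ℝ P) y u v = fderiv ℝ (fderiv ℝ P) y v u :=
    (hP.isSymmSndFDerivAt (by simpa using two_le_infty)).eq u v
  rw [curvature, key, key, hs]
  abel

theorem secondFF_mem (u v : Euc k) : secondFF g y u v ∈ (tangentSpan g y)ᗮ :=
  normalProj_mem _

theorem inner_fderiv_of_mem_orthogonal {ν : Euc n} (hν : ν ∈ (tangentSpan g y)ᗮ) (u : Euc k) :
    inner ℝ (fderiv ℝ g y u) ν = 0 :=
  (Submodule.mem_orthogonal _ _).mp hν _ (fderiv_mem_tangentSpan u)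

/-- The Gauss equation. -/
theorem inner_curvature_tangentProj (hg : ContDiffAt ℝ ∞ g y)
    (h : Function.Injective (fderiv ℝ g y)) (u v w z : Euc k) :
    inner ℝ (curvature (tangentProj g) u v (fderiv ℝ g y w) y) (fderiv ℝ g y z) =
      inner ℝ (secondFF g y v w) (secondFF g y u z) -
        inner ℝ (secondFF g y u w) (secondFF g y v z) := by
  have hP := contDiffAt_tangentProj hg h
  have hd := hP.differentiableAt (by simp)
  rw [curvature_eq hP, inner_sub_left, inner_tangentProj, inner_tangentProj, tangentProj_fderiv,
    inner_fderiv_tangentProj hd u, inner_fderiv_tangentProj hd v _ (fderiv ℝ g y z)]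
  simp only [fderiv_tangentProj_fderiv hg h]

/-- The Ricci equation. -/
theorem inner_curvature_normalProj (hg : ContDiffAt ℝ ∞ g y)
    (h : Function.Injective (fderiv ℝ g y)) (u v : Euc k) {ν μ : Euc n}
    (hμ : μ ∈ (tangentSpan g y)ᗮ) :
    inner ℝ (curvature (normalProj g) u v ν y) μ =
      inner ℝ (fderiv ℝ (tangentProj g) y v ν) (fderiv ℝ (tangentProj g) y u μ) -
        inner ℝ (fderiv ℝ (tangentProj g) y u ν) (fderiv ℝ (tangentProj g) y v μ) := by
  have hP := contDiffAt_tangentProj hg h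
  have hd := hP.differentiableAt (by simp)
  have hQ : ContDiffAt ℝ ∞ (normalProj g) y := by
    have : normalProj g = fun z => ContinuousLinearMap.id ℝ (Euc n) - tangentProj g z := by
      funext z; exact normalProj_eq
    rw [this]
    exact contDiffAt_const.sub hP
  have hs (v w : Euc n) : inner ℝ (normalProj g y v) w = inner ℝ v (normalProj g y w) :=
    Submodule.inner_starProjection_left_eq_right (tangentSpan g y)ᗮ _ _
  rw [curvature_eq hQ, inner_sub_left, hs, hs, normalProj_eq_self hμ]
  simp only [fderiv_normalProj, neg_apply, map_neg, neg_neg]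
  rw [inner_fderiv_tangentProj hd u, inner_fderiv_tangentProj hd v _ μ]

theorem secondFF_symm (hg : ContDiffAt ℝ ∞ g y) (u v : Euc k) :
    secondFF g y u v = secondFF g y v u := by
  rw [secondFF, secondFF, (hg.isSymmSndFDerivAt (by simpa using two_le_infty)).eq u v]

theorem secondFF_sum_left {ι : Type*} (s : Finset ι) (f : ι → Euc k) (v : Euc k) :
    secondFF g y (∑ i ∈ s, f i) v = ∑ i ∈ s, secondFF g y (f i) v := by
  simp only [secondFF, map_sum, sum_apply]

theorem secondFF_sum_right {ι : Type*} (s : Finset ι) (f : ι → Euc k) (v : Euc k) :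
    secondFF g y v (∑ i ∈ s, f i) = ∑ i ∈ s, secondFF g y v (f i) := by
  simp only [secondFF, map_sum]

theorem secondFF_smul_left (a : ℝ) (u v : Euc k) :
    secondFF g y (a • u) v = a • secondFF g y u v := by
  simp only [secondFF, map_smul, smul_apply]

theorem secondFF_smul_right (a : ℝ) (u v : Euc k) :
    secondFF g y u (a • v) = a • secondFF g y u v := by
  simp only [secondFF, map_smul]

/-- The mean curvature vector in terms of an orthonormal frame. -/
theorem meanCurv_eq_of_isTangentFrame {e : Fin k → Euc k} (he : IsTangentFrame g y e) :
    meanCurv g y = (k : ℝ)⁻¹ • ∑ l, secondFF g y (e l) (e l) := by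
  have he1 (l : Fin k) : e l = ∑ i, (e l) i • EuclideanSpace.single i (1 : ℝ) :=
    apply_eq_sum_single (LinearMap.id) (e l)
  set B : Matrix (Fin k) (Fin k) ℝ := Matrix.of fun i l => e l i with hB
  -- With B the matrix of the frame, orthonormality reads Bᵀ G B = 1, whence G⁻¹ = B Bᵀ.
  have h1 : B.transpose * (gram g y * B) = 1 := by
    ext l l'
    rw [Matrix.one_apply, ← orthonormal_iff_ite.mp he l l', he1 l, he1 l', map_sum, map_sum,
      sum_inner]
    simp only [inner_sum, map_smul, real_inner_smul_left, real_inner_smul_right, Matrix.mul_apply,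
      Matrix.transpose_apply, hB, Matrix.of_apply, gram, Finset.mul_sum]
    refine Finset.sum_congr rfl fun i _ => Finset.sum_congr rfl fun j _ => ?_
    ring
  have h2 : (gram g y)⁻¹ = B * B.transpose := by
    have h3 : gram g y * B * B.transpose = 1 := mul_eq_one_comm.mp h1
    exact Matrix.inv_eq_right_inv (by rw [← Matrix.mul_assoc, h3])
  rw [meanCurv, h2]
  congr 1
  have h4 (l : Fin k) : secondFF g y (e l) (e l) = ∑ i, ∑ j, (B i l * B j l) •
      secondFF g y (EuclideanSpace.single i 1) (EuclideanSpace.single j 1) := by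
    conv_lhs => rw [he1 l]
    rw [secondFF_sum_left]
    refine Finset.sum_congr rfl fun i _ => ?_
    rw [secondFF_sum_right]
    refine Finset.sum_congr rfl fun j _ => ?_
    rw [secondFF_smul_left, secondFF_smul_right, smul_smul]
    rfl
  simp only [h4, Matrix.mul_apply, Matrix.transpose_apply, Finset.sum_smul]
  rw [Finset.sum_comm (γ := Fin k) (s := Finset.univ) (t := Finset.univ)
    (f := fun l i => ∑ j, (B i l * B j l) •
      secondFF g y (EuclideanSpace.single i 1) (EuclideanSpace.single j 1))]
  exact Finset.sum_congr rfl fun i _ => Finset.sum_comm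

end Geometry

end Submfd

namespace Submfd

/-! ### The DDVV equality in codimension two -/

section Wintgen

variable {k n : ℕ}

theorem sum_univ_eq_two_mul_sum_Ioi {f : Fin k → Fin k → ℝ} (hs : ∀ i j, f i j = f j i)
    (hd : ∀ i, f i i = 0) : ∑ i, ∑ j, f i j = 2 * ∑ i, ∑ j ∈ Finset.Ioi i, f i j := by
  have h1 (i : Fin k) : ∑ j, f i j = ∑ j ∈ Finset.Ioi i, f i j + ∑ j ∈ Finset.Iio i, f i j := by
    rw [← Finset.sum_filter_add_sum_filter_not Finset.univ (fun j => i < j)]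
    congr 1
    · exact Finset.sum_congr (by ext; simp) fun _ _ => rfl
    · symm
      refine Finset.sum_subset (by intro j; simp; exact le_of_lt) fun j hj hj2 => ?_
      have : i = j := by simp at hj hj2; exact le_antisymm hj2 hj
      rw [this, hd]
  have h2 : ∑ i, ∑ j ∈ Finset.Iio i, f i j = ∑ i, ∑ j ∈ Finset.Ioi i, f i j := by
    rw [Finset.sum_comm' (s' := fun j => Finset.Ioi j) (t' := Finset.univ) (by simp)]
    exact Finset.sum_congr rfl fun j _ => Finset.sum_congr rfl fun i _ => hs i j
  simp only [h1, Finset.sum_add_distrib, h2]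
  ring

/-- The traceless part of the second fundamental form. -/
noncomputable def tracelessFF (g : Euc k → Euc n) (y u w : Euc k) : Euc n :=
  secondFF g y u w - (inner ℝ (fderiv ℝ g y u) (fderiv ℝ g y w) : ℝ) • meanCurv g y

/-- The component of the traceless second fundamental form along `ν 0 - i ν 1`. -/
noncomputable def complexFF (g : Euc k → Euc n) (y : Euc k) (ν : Fin 2 → Euc n) (u w : Euc k) : ℂ :=
  (inner ℝ (ν 0) (tracelessFF g y u w) : ℝ) - Complex.I * (inner ℝ (ν 1) (tracelessFF g y u w) : ℝ)

/-- The traceless second fundamental form has the shape that characterizes equality in the DDVV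
inequality in codimension two: its complex component has rank at most one and square zero. -/
def IsWintgenAt (g : Euc k → Euc (k + 2)) (y : Euc k) : Prop :=
  ∃ e : Fin k → Euc k, IsTangentFrame g y e ∧ ∀ ν, IsNormalFrame g y ν →
    (∀ u v w z, complexFF g y ν u w * complexFF g y ν v z =
      complexFF g y ν u z * complexFF g y ν v w) ∧
    ∀ u w, ∑ l, complexFF g y ν u (e l) * complexFF g y ν w (e l) = 0

theorem exists_orthonormalBasis {g : Euc k → Euc (k + 2)} {y : Euc k} {e : Fin k → Euc k}
    {ν : Fin 2 → Euc (k + 2)} (he : IsTangentFrame g y e) (hν : IsNormalFrame g y ν) :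
    ∃ b : OrthonormalBasis (Fin k ⊕ Fin 2) ℝ (Euc (k + 2)),
      (∀ i, b (Sum.inl i) = fderiv ℝ g y (e i)) ∧ ∀ a, b (Sum.inr a) = ν a := by
  have ho : Orthonormal ℝ (Sum.elim (fun i => fderiv ℝ g y (e i)) ν) := by
    rw [orthonormal_iff_ite]
    have h1 := orthonormal_iff_ite.mp he
    have h2 := orthonormal_iff_ite.mp hν.1
    have h3 (i a) := inner_fderiv_of_mem_orthogonal (hν.2 a) (e i)
    rintro (i | a) (j | b)
    · simpa using h1 i j
    · simpa using h3 i b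
    · simpa [real_inner_comm] using h3 j a
    · simpa using h2 a b
  have hc : Fintype.card (Fin k ⊕ Fin 2) = Module.finrank ℝ (Euc (k + 2)) := by simp
  refine ⟨(basisOfOrthonormalOfCardEqFinrank ho hc).toOrthonormalBasis (by simpa using ho),
    fun i => by simp, fun a => by simp⟩

theorem inner_eq_sum_frame {g : Euc k → Euc (k + 2)} {y : Euc k} {e : Fin k → Euc k}
    {ν : Fin 2 → Euc (k + 2)} (he : IsTangentFrame g y e) (hν : IsNormalFrame g y ν)
    (v w : Euc (k + 2)) : inner ℝ v w =
      ∑ i, inner ℝ (fderiv ℝ g y (e i)) v * inner ℝ (fderiv ℝ g y (e i)) w +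
        (inner ℝ (ν 0) v * inner ℝ (ν 0) w + inner ℝ (ν 1) v * inner ℝ (ν 1) w) := by
  obtain ⟨b, h1, h2⟩ := exists_orthonormalBasis he hν
  rw [← b.sum_inner_mul_inner v w, Fintype.sum_sum_type, Fin.sum_univ_two]
  simp only [h1, h2, real_inner_comm v]

theorem inner_eq_of_mem_orthogonal {g : Euc k → Euc (k + 2)} {y : Euc k} {e : Fin k → Euc k}
    {ν : Fin 2 → Euc (k + 2)} (he : IsTangentFrame g y e) (hν : IsNormalFrame g y ν)
    {v : Euc (k + 2)} (hv : v ∈ (tangentSpan g y)ᗮ) (w : Euc (k + 2)) : inner ℝ v w =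
      inner ℝ (ν 0) v * inner ℝ (ν 0) w + inner ℝ (ν 1) v * inner ℝ (ν 1) w := by
  rw [inner_eq_sum_frame he hν]
  simp [inner_fderiv_of_mem_orthogonal hv]

theorem meanCurv_mem {g : Euc k → Euc n} {y : Euc k} : meanCurv g y ∈ (tangentSpan g y)ᗮ :=
  Submodule.smul_mem _ _ (Submodule.sum_mem _ fun _ _ => Submodule.sum_mem _ fun _ _ =>
    Submodule.smul_mem _ _ (secondFF_mem _ _))

theorem tracelessFF_mem {g : Euc k → Euc n} {y : Euc k} (u w : Euc k) :
    tracelessFF g y u w ∈ (tangentSpan g y)ᗮ :=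
  Submodule.sub_mem _ (secondFF_mem _ _) (Submodule.smul_mem _ _ meanCurv_mem)

/-- The Gauss equation turns the scalar curvature into k²|H|² - |II|², and the Ricci equation turns
the normal curvature into the commutator of the shape operators. The equality then compares that
commutator with the norm of the traceless part |II|² - k|H|². -/
theorem DDVVEquality.commutator {g : Euc k → Euc (k + 2)} {y : Euc k} (hk : 2 ≤ k)
    (hg : ContDiffAt ℝ ∞ g y) (hi : Function.Injective (fderiv ℝ g y)) {e : Fin k → Euc k}
    {ν : Fin 2 → Euc (k + 2)} (he : IsTangentFrame g y e) (hν : IsNormalFrame g y ν)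
    (h : normScalarCurv g y e + normNormalCurv g y e ν = ‖meanCurv g y‖ ^ 2) (a b : Fin k → Fin k → ℝ)
    (ha : ∀ i j, a i j = inner ℝ (ν 0) (tracelessFF g y (e i) (e j)))
    (hb : ∀ i j, b i j = inner ℝ (ν 1) (tracelessFF g y (e i) (e j))) :
    2 * ∑ i, ∑ j, (∑ l, (a i l * b j l - b i l * a j l)) ^ 2 =
      (∑ i, ∑ j, (a i j ^ 2 + b i j ^ 2)) ^ 2 := by
  set A : Fin k → Fin k → ℝ := fun i j => inner ℝ (ν 0) (secondFF g y (e i) (e j)) with hA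
  set B : Fin k → Fin k → ℝ := fun i j => inner ℝ (ν 1) (secondFF g y (e i) (e j)) with hB
  set p : ℝ := inner ℝ (ν 0) (meanCurv g y) with hp
  set q : ℝ := inner ℝ (ν 1) (meanCurv g y) with hq
  have hd := (contDiffAt_tangentProj hg hi).differentiableAt (by simp)
  have hk0 : (k : ℝ) ≠ 0 := by positivity
  have hk1 : (k : ℝ) - 1 ≠ 0 := by
    have : (2 : ℝ) ≤ k := by exact_mod_cast hk
    linarith
  have hAs (i j) : A i j = A j i := by simp only [hA]; rw [secondFF_symm hg]
  have hBs (i j) : B i j = B j i := by simp only [hB]; rw [secondFF_symm hg]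
  have ha' (i j) : a i j = A i j - if i = j then p else 0 := by
    rw [ha, tracelessFF, inner_sub_right, real_inner_smul_right, orthonormal_iff_ite.mp he i j]
    simp [hA, hp]
  have hb' (i j) : b i j = B i j - if i = j then q else 0 := by
    rw [hb, tracelessFF, inner_sub_right, real_inner_smul_right, orthonormal_iff_ite.mp he i j]
    simp [hB, hq]
  have hpA : ∑ i, A i i = k * p := by
    rw [hp, meanCurv_eq_of_isTangentFrame he, real_inner_smul_right, inner_sum]
    field_simp
    rfl
  have hqB : ∑ i, B i i = k * q := by
    rw [hq, meanCurv_eq_of_isTangentFrame he, real_inner_smul_right, inner_sum]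
    field_simp
    rfl
  have hH : ‖meanCurv g y‖ ^ 2 = p ^ 2 + q ^ 2 := by
    rw [← real_inner_self_eq_norm_sq, inner_eq_of_mem_orthogonal he hν meanCurv_mem]
    ring
  set f : Fin k → Fin k → ℝ := fun i j => (A i i * A j j + B i i * B j j) - (A i j ^ 2 + B i j ^ 2)
    with hf
  have hgauss (i j) : inner ℝ (curvature (tangentProj g) (e i) (e j) (fderiv ℝ g y (e j)) y)
      (fderiv ℝ g y (e i)) = f i j := by
    rw [inner_curvature_tangentProj hg hi, inner_eq_of_mem_orthogonal he hν (secondFF_mem _ _),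
      inner_eq_of_mem_orthogonal he hν (secondFF_mem _ _)]
    change A j j * A i i + B j j * B i i - (A i j * A j i + B i j * B j i) = _
    rw [hAs j i, hBs j i, hf]
    ring
  set K : Fin k → Fin k → ℝ := fun i j => ∑ l, (A i l * B j l - B i l * A j l) with hK
  -- On normal vectors dP is the shape operator: its tangential components are given here, and by
  -- `hDN` it has no normal ones.
  have hDP (i l : Fin k) (μ : Euc (k + 2)) : inner ℝ (fderiv ℝ g y (e l))
      (fderiv ℝ (tangentProj g) y (e i) μ) = inner ℝ μ (secondFF g y (e i) (e l)) := by
    rw [← inner_fderiv_tangentProj hd, fderiv_tangentProj_fderiv hg hi, real_inner_comm]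
  have hDN (i : Fin k) (μ : Euc (k + 2)) (hμ : μ ∈ (tangentSpan g y)ᗮ) (a : Fin 2) :
      inner ℝ (ν a) (fderiv ℝ (tangentProj g) y (e i) μ) = 0 := by
    rw [← tangentProj_fderiv_tangentProj hd _ hμ, ← inner_tangentProj, tangentProj_eq_zero (hν.2 a),
      inner_zero_left]
  have hDD (i j : Fin k) : inner ℝ (fderiv ℝ (tangentProj g) y (e i) (ν 0))
      (fderiv ℝ (tangentProj g) y (e j) (ν 1)) = ∑ l, A i l * B j l := by
    rw [inner_eq_sum_frame he hν, hDN _ _ (hν.2 0), hDN _ _ (hν.2 0)]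
    simp only [hDP, zero_mul, add_zero]
    rfl
  have hricci (i j) : inner ℝ (curvature (normalProj g) (e i) (e j) (ν 0) y) (ν 1) = - K i j := by
    rw [inner_curvature_normalProj hg hi _ _ (hν.2 1), hDD, hDD]
    simp only [hK, ← Finset.sum_sub_distrib, ← Finset.sum_neg_distrib]
    exact Finset.sum_congr rfl fun l _ => by ring
  have hKs (i j) : K i j ^ 2 = K j i ^ 2 := by
    have : K i j = - K j i := by
      simp only [hK, ← Finset.sum_neg_distrib]
      exact Finset.sum_congr rfl fun l _ => by ring
    rw [this, neg_sq]
  have hKd (i) : K i i ^ 2 = 0 := by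
    have : K i i = 0 := Finset.sum_eq_zero fun l _ => by ring
    rw [this, sq, zero_mul]
  have hG := sum_univ_eq_two_mul_sum_Ioi (f := f) (fun i j => by simp only [hf, hAs i j, hBs i j]; ring)
    (fun i => by simp only [hf]; ring)
  have hR := sum_univ_eq_two_mul_sum_Ioi (f := fun i j => K i j ^ 2) hKs hKd
  have h2 (F : Fin 2 → Fin 2 → ℝ) : ∑ a, ∑ b ∈ Finset.Ioi a, F a b = F 0 1 := by
    have e0 : (Finset.Ioi 0 : Finset (Fin 2)) = {1} := by decide
    have e1 : (Finset.Ioi 1 : Finset (Fin 2)) = ∅ := by decide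
    simp [Fin.sum_univ_two, e0, e1]
  rw [normScalarCurv, normNormalCurv, hH] at h
  simp only [h2, hgauss, hricci, neg_sq] at h
  set G := ∑ i, ∑ j ∈ Finset.Ioi i, f i j
  set R := ∑ i, ∑ j ∈ Finset.Ioi i, K i j ^ 2 with hRdef
  have hR0 : 0 ≤ R := Finset.sum_nonneg fun i _ => Finset.sum_nonneg fun j _ => sq_nonneg _
  have hab : ∑ i, ∑ j, (a i j ^ 2 + b i j ^ 2) =
      ∑ i, ∑ j, (A i j ^ 2 + B i j ^ 2) - k * (p ^ 2 + q ^ 2) := by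
    have : ∀ i j, a i j ^ 2 + b i j ^ 2 = (A i j ^ 2 + B i j ^ 2) +
        (if i = j then - 2 * p * A i j - 2 * q * B i j + (p ^ 2 + q ^ 2) else 0) := by
      intro i j
      rw [ha', hb']
      split_ifs <;> ring
    simp only [this, Finset.sum_add_distrib, Finset.sum_ite_eq, Finset.mem_univ, if_true,
      Finset.sum_sub_distrib, ← Finset.mul_sum, hpA, hqB, Finset.sum_const, Finset.card_univ,
      Fintype.card_fin, nsmul_eq_mul]
    ring
  have hfs : ∑ i, ∑ j, f i j = (k * p) ^ 2 + (k * q) ^ 2 - ∑ i, ∑ j, (A i j ^ 2 + B i j ^ 2) := by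
    rw [← hpA, ← hqB, sq, sq, Finset.sum_mul_sum, Finset.sum_mul_sum]
    simp only [hf, Finset.sum_sub_distrib, Finset.sum_add_distrib]
  -- The hypothesis is 2G + 2√R = k(k-1)|H|², and 2G = k²|H|² - |II|² by `hG` and `hfs`. This leaves
  -- 2√R = |II|² - k|H|².
  have hsq : 2 * Real.sqrt R = ∑ i, ∑ j, (a i j ^ 2 + b i j ^ 2) := by
    field_simp at h
    rw [hab]
    linarith
  -- Passing to traceless parts subtracts multiples of the identity, which do not affect the
  -- commutator.
  have hKab (i j) : ∑ l, (a i l * b j l - b i l * a j l) = K i j := by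
    have : ∀ l, a i l * b j l - b i l * a j l = (A i l * B j l - B i l * A j l) +
        ((if i = l then q * A j l - p * B j l else 0) +
          (if j = l then p * B i l - q * A i l else 0)) := by
      intro l
      rw [ha', hb', ha', hb']
      split_ifs with h1 h2
      · subst h1; subst h2; ring
      · ring
      · ring
      · ring
    simp only [this, Finset.sum_add_distrib, Finset.sum_ite_eq, Finset.mem_univ, if_true]
    rw [hAs j i, hBs j i]
    simp only [hK]
    ring
  simp only [hKab]
  rw [hR, ← hsq, mul_pow, Real.sq_sqrt hR0]
  ring

theorem tracelessFF_symm {g : Euc k → Euc n} {y : Euc k} (hg : ContDiffAt ℝ ∞ g y) (u w : Euc k) :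
    tracelessFF g y u w = tracelessFF g y w u := by
  rw [tracelessFF, tracelessFF, secondFF_symm hg, real_inner_comm]

theorem complexFF_symm {g : Euc k → Euc n} {y : Euc k} (hg : ContDiffAt ℝ ∞ g y)
    (ν : Fin 2 → Euc n) (u w : Euc k) : complexFF g y ν u w = complexFF g y ν w u := by
  rw [complexFF, complexFF, tracelessFF_symm hg]

theorem tracelessFF_sum_smul_left {g : Euc k → Euc n} {y : Euc k} {ι : Type*} (s : Finset ι)
    (a : ι → ℝ) (f : ι → Euc k) (w : Euc k) :
    tracelessFF g y (∑ i ∈ s, a i • f i) w = ∑ i ∈ s, a i • tracelessFF g y (f i) w := by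
  simp only [tracelessFF, secondFF_sum_left, secondFF_smul_left, map_sum, map_smul, sum_inner,
    real_inner_smul_left, smul_sub, Finset.sum_sub_distrib, Finset.sum_smul, smul_smul]

theorem complexFF_sum_smul_left {g : Euc k → Euc n} {y : Euc k} (ν : Fin 2 → Euc n) {ι : Type*}
    (s : Finset ι) (a : ι → ℝ) (f : ι → Euc k) (w : Euc k) :
    complexFF g y ν (∑ i ∈ s, a i • f i) w = ∑ i ∈ s, (a i : ℂ) * complexFF g y ν (f i) w := by
  simp only [complexFF, tracelessFF_sum_smul_left, inner_sum, real_inner_smul_right,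
    Complex.ofReal_sum, Complex.ofReal_mul, Finset.mul_sum, ← Finset.sum_sub_distrib]
  exact Finset.sum_congr rfl fun i _ => by ring

theorem eq_sum_tangentFrame {g : Euc k → Euc n} {y : Euc k} {e : Fin k → Euc k}
    (he : IsTangentFrame g y e) (u : Euc k) :
    ∃ a : Fin k → ℝ, u = ∑ i, a i • e i := by
  have hl : LinearIndependent ℝ e :=
    LinearIndependent.of_comp (fderiv ℝ g y).toLinearMap he.linearIndependent
  have hs : u ∈ Submodule.span ℝ (Set.range e) := by
    rw [hl.span_eq_top_of_card_eq_finrank' (by simp)]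
    trivial
  obtain ⟨a, ha⟩ := (Submodule.mem_span_range_iff_exists_fun ℝ).mp hs
  exact ⟨a, ha.symm⟩

/-- Two normal frames differ by an element of O(2). A rotation multiplies ν₀ - i ν₁ by a complex
number, and a reflection conjugates it as well. Vanishing of minors and of the square survives both,
so one frame suffices for the condition in `IsWintgenAt`. -/
theorem complexFF_eq_mul_or {g : Euc k → Euc (k + 2)} {y : Euc k} {e : Fin k → Euc k}
    {ν μ : Fin 2 → Euc (k + 2)} (he : IsTangentFrame g y e) (hν : IsNormalFrame g y ν)
    (hμ : IsNormalFrame g y μ) : ∃ a : ℂ, (∀ u w, complexFF g y μ u w = a * complexFF g y ν u w) ∨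
      ∀ u w, complexFF g y μ u w = a * starRingEnd ℂ (complexFF g y ν u w) := by
  set r : Fin 2 → Fin 2 → ℝ := fun a b => inner ℝ (ν b) (μ a) with hr
  have ho (a b) : r a 0 * r b 0 + r a 1 * r b 1 = if a = b then 1 else 0 := by
    rw [← orthonormal_iff_ite.mp hμ.1 a b, inner_eq_of_mem_orthogonal he hν (hμ.2 a)]
  have h00 := ho 0 0
  have h11 := ho 1 1
  have h01 := ho 0 1
  simp only [if_true, zero_ne_one, if_false] at h00 h11 h01
  have hc (a u w) : inner ℝ (μ a) (tracelessFF g y u w) =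
      r a 0 * inner ℝ (ν 0) (tracelessFF g y u w) + r a 1 * inner ℝ (ν 1) (tracelessFF g y u w) :=
    inner_eq_of_mem_orthogonal he hν (hμ.2 a) _
  have hd : (r 0 0 * r 1 1 - r 0 1 * r 1 0) ^ 2 = 1 := by
    linear_combination h11 * (r 0 0 * r 0 0 + r 0 1 * r 0 1) + h00 -
      (r 0 0 * r 1 0 + r 0 1 * r 1 1) * h01
  have hI := Complex.I_sq
  rcases mul_self_eq_one_iff.mp ((sq _).symm.trans hd) with hd | hd
  -- For an orthogonal 2×2 matrix, (r₁₁ - r₀₀)² + (r₁₀ + r₀₁)² = 2 - 2 det. With det = 1 both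
  -- squares vanish; the case det = -1 is alike with the opposite signs.
  · have h1 : r 1 1 - r 0 0 = 0 := by
      nlinarith [sq_nonneg (r 1 1 - r 0 0), sq_nonneg (r 1 0 + r 0 1)]
    have h2 : r 1 0 + r 0 1 = 0 := by
      nlinarith [sq_nonneg (r 1 1 - r 0 0), sq_nonneg (r 1 0 + r 0 1)]
    refine ⟨r 0 0 + Complex.I * r 0 1, Or.inl fun u w => ?_⟩
    rw [complexFF, hc, hc, eq_neg_of_add_eq_zero_left h2, sub_eq_zero.mp h1, complexFF]
    push_cast
    linear_combination ((r 0 1 : ℂ) * (inner ℝ (ν 1) (tracelessFF g y u w) : ℝ)) * hI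
  · have h1 : r 1 1 + r 0 0 = 0 := by
      nlinarith [sq_nonneg (r 1 1 + r 0 0), sq_nonneg (r 1 0 - r 0 1)]
    have h2 : r 1 0 - r 0 1 = 0 := by
      nlinarith [sq_nonneg (r 1 1 + r 0 0), sq_nonneg (r 1 0 - r 0 1)]
    refine ⟨r 0 0 - Complex.I * r 0 1, Or.inr fun u w => ?_⟩
    rw [complexFF, hc, hc, eq_neg_of_add_eq_zero_left h1, sub_eq_zero.mp h2, complexFF]
    simp only [map_sub, map_mul, Complex.conj_ofReal, Complex.conj_I]
    push_cast
    linear_combination ((r 0 1 : ℂ) * (inner ℝ (ν 1) (tracelessFF g y u w) : ℝ)) * hI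

/-- The extremal commutator gives the relations on one pair of frames. Multilinearity extends them
to all tangent vectors and `complexFF_eq_mul_or` to all normal frames. -/
theorem DDVVEquality.isWintgenAt {g : Euc k → Euc (k + 2)} {y : Euc k} (hk : 2 ≤ k)
    (hg : ContDiffAt ℝ ∞ g y) (hi : Function.Injective (fderiv ℝ g y)) (h : DDVVEquality g y) :
    IsWintgenAt g y := by
  obtain ⟨e, ν, he, hν, heq⟩ := h
  have hs := complexFF_symm hg ν
  obtain ⟨h1, h2⟩ := minors_eq_zero_of_commutator
    (Matrix.of fun i j => inner ℝ (ν 0) (tracelessFF g y (e i) (e j)))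
    (Matrix.of fun i j => inner ℝ (ν 1) (tracelessFF g y (e i) (e j)))
    (fun i j => by simp only [Matrix.of_apply]; rw [tracelessFF_symm hg])
    (fun i j => by simp only [Matrix.of_apply]; rw [tracelessFF_symm hg])
    (DDVVEquality.commutator hk hg hi he hν heq _ _ (fun i j => rfl) fun i j => rfl)
  change ∀ i j l l', complexFF g y ν (e i) (e l) * complexFF g y ν (e j) (e l') =
    complexFF g y ν (e i) (e l') * complexFF g y ν (e j) (e l) at h1
  change ∀ i j, ∑ l, complexFF g y ν (e i) (e l) * complexFF g y ν (e j) (e l) = 0 at h2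
  -- Basis vectors are replaced by arbitrary ones a slot at a time.
  have m1 : ∀ u j l l', complexFF g y ν u (e l) * complexFF g y ν (e j) (e l') =
      complexFF g y ν u (e l') * complexFF g y ν (e j) (e l) := by
    intro u j l l'
    obtain ⟨a, rfl⟩ := eq_sum_tangentFrame he u
    simp only [complexFF_sum_smul_left, Finset.sum_mul, mul_assoc, h1 _ j l l']
  have m2 : ∀ u v l l', complexFF g y ν u (e l) * complexFF g y ν v (e l') =
      complexFF g y ν u (e l') * complexFF g y ν v (e l) := by
    intro u v l l'
    obtain ⟨a, rfl⟩ := eq_sum_tangentFrame he v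
    simp only [complexFF_sum_smul_left, Finset.mul_sum, mul_left_comm _ (Complex.ofReal _),
      m1 u _ l l']
  have m3 : ∀ u v w l', complexFF g y ν u w * complexFF g y ν v (e l') =
      complexFF g y ν u (e l') * complexFF g y ν v w := by
    intro u v w l'
    obtain ⟨a, rfl⟩ := eq_sum_tangentFrame he w
    rw [hs u, hs v (∑ i, a i • e i)]
    simp only [complexFF_sum_smul_left, Finset.mul_sum, Finset.sum_mul]
    refine Finset.sum_congr rfl fun i _ => ?_
    rw [hs _ u, hs _ v]
    linear_combination (a i : ℂ) * m2 u v i l'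
  have m4 : ∀ u v w z, complexFF g y ν u w * complexFF g y ν v z =
      complexFF g y ν u z * complexFF g y ν v w := by
    intro u v w z
    obtain ⟨a, rfl⟩ := eq_sum_tangentFrame he z
    rw [hs u (∑ i, a i • e i), hs v (∑ i, a i • e i)]
    simp only [complexFF_sum_smul_left, Finset.mul_sum, Finset.sum_mul]
    refine Finset.sum_congr rfl fun i _ => ?_
    rw [hs _ u, hs _ v]
    linear_combination (a i : ℂ) * m3 u v w i
  have n1 : ∀ u j, ∑ l, complexFF g y ν u (e l) * complexFF g y ν (e j) (e l) = 0 := by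
    intro u j
    obtain ⟨a, rfl⟩ := eq_sum_tangentFrame he u
    simp only [complexFF_sum_smul_left, Finset.sum_mul]
    rw [Finset.sum_comm]
    simp only [mul_assoc, ← Finset.mul_sum, h2, mul_zero, Finset.sum_const_zero]
  have n2 : ∀ u v, ∑ l, complexFF g y ν u (e l) * complexFF g y ν v (e l) = 0 := by
    intro u v
    obtain ⟨a, rfl⟩ := eq_sum_tangentFrame he v
    simp only [complexFF_sum_smul_left, Finset.mul_sum]
    rw [Finset.sum_comm]
    simp only [mul_left_comm _ (Complex.ofReal _), ← Finset.mul_sum, n1, mul_zero,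
      Finset.sum_const_zero]
  refine ⟨e, he, fun μ hμ => ?_⟩
  obtain ⟨a, ha | ha⟩ := complexFF_eq_mul_or he hν hμ
  · refine ⟨fun u v w z => ?_, fun u w => ?_⟩
    · rw [ha, ha, ha, ha]
      linear_combination a ^ 2 * m4 u v w z
    · have : ∀ l, complexFF g y μ u (e l) * complexFF g y μ w (e l) =
          a ^ 2 * (complexFF g y ν u (e l) * complexFF g y ν w (e l)) := by
        intro l; rw [ha, ha]; ring
      simp only [this, ← Finset.mul_sum, n2, mul_zero]
  · refine ⟨fun u v w z => ?_, fun u w => ?_⟩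
    · rw [ha, ha, ha, ha]
      have := congrArg (starRingEnd ℂ) (m4 u v w z)
      rw [map_mul, map_mul] at this
      linear_combination a ^ 2 * this
    · have : ∀ l, complexFF g y μ u (e l) * complexFF g y μ w (e l) =
          a ^ 2 * starRingEnd ℂ (complexFF g y ν u (e l) * complexFF g y ν w (e l)) := by
        intro l; rw [ha, ha, map_mul]; ring
      simp only [this, ← Finset.mul_sum, ← map_sum, n2, map_zero, mul_zero]

/-- At a non-umbilic point some diagonal value of the traceless second fundamental form does not
vanish. -/
theorem IsWintgenAt.exists_complexFF_ne_zero {g : Euc k → Euc (k + 2)} {y : Euc k}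
    (h : IsWintgenAt g y) (hg : ContDiffAt ℝ ∞ g y) {ν : Fin 2 → Euc (k + 2)}
    (hν : IsNormalFrame g y ν) (hu : ∃ u w, tracelessFF g y u w ≠ 0) :
    ∃ v, complexFF g y ν v v ≠ 0 := by
  obtain ⟨e, he, h⟩ := h
  obtain ⟨u, w, huw⟩ := hu
  have hc : complexFF g y ν u w ≠ 0 := by
    intro h0
    apply huw
    rw [complexFF, Complex.ext_iff] at h0
    simp only [Complex.sub_re, Complex.ofReal_re, Complex.mul_re, Complex.I_re, zero_mul,
      Complex.I_im, Complex.ofReal_im, mul_zero, sub_zero, Complex.zero_re, Complex.sub_im,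
      Complex.mul_im, one_mul, zero_add, zero_sub, neg_eq_zero, Complex.zero_im] at h0
    rw [← inner_self_eq_zero (𝕜 := ℝ), inner_eq_of_mem_orthogonal he hν (tracelessFF_mem u w),
      h0.1, h0.2]
    ring
  by_contra! h0
  -- For a symmetric form with vanishing minors, C(u, w)² = C(u, u) C(w, w).
  have := (h ν hν).1 u w w u
  rw [complexFF_symm hg ν w u, h0 u, zero_mul] at this
  exact hc (mul_self_eq_zero.mp this)

/-! ### Invariance under reparametrization -/

section Reparametrization

variable {g : Euc k → Euc n} {τ : Euc k → Euc k} {z : Euc k}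

theorem fderiv_comp_reparam (hg : ContDiffAt ℝ ∞ g (τ z)) (hτ : ContDiffAt ℝ ∞ τ z) (u : Euc k) :
    fderiv ℝ (g ∘ τ) z u = fderiv ℝ g (τ z) (fderiv ℝ τ z u) := by
  rw [fderiv_comp z (hg.differentiableAt (by simp)) (hτ.differentiableAt (by simp))]
  rfl

theorem tangentSpan_comp (hg : ContDiffAt ℝ ∞ g (τ z)) (hτ : ContDiffAt ℝ ∞ τ z)
    (hs : Function.Surjective (fderiv ℝ τ z)) :
    tangentSpan (g ∘ τ) z = tangentSpan g (τ z) := by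
  ext w
  constructor
  · rintro ⟨u, rfl⟩
    exact ⟨fderiv ℝ τ z u, (fderiv_comp_reparam hg hτ u).symm⟩
  · rintro ⟨u, rfl⟩
    obtain ⟨v, rfl⟩ := hs u
    exact ⟨v, fderiv_comp_reparam hg hτ v⟩

theorem secondFF_comp (hg : ContDiffAt ℝ ∞ g (τ z)) (hτ : ContDiffAt ℝ ∞ τ z)
    (hs : Function.Surjective (fderiv ℝ τ z)) (u w : Euc k) :
    secondFF (g ∘ τ) z u w = secondFF g (τ z) (fderiv ℝ τ z u) (fderiv ℝ τ z w) := by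
  have hτd : DifferentiableAt ℝ τ z := hτ.differentiableAt (by simp)
  have h1 : ∀ᶠ y in nhds z, DifferentiableAt ℝ τ y :=
    ((hτ.of_le two_le_infty).eventually (by decide)).mono fun y hy => hy.differentiableAt (by simp)
  have h2 : ∀ᶠ y in nhds z, DifferentiableAt ℝ g (τ y) :=
    hτ.continuousAt.eventually (((hg.of_le two_le_infty).eventually (by decide)).mono
      fun y hy => hy.differentiableAt (by simp))
  have h3 : (fun y => fderiv ℝ (g ∘ τ) y w) =ᶠ[nhds z]
      fun y => fderiv ℝ g (τ y) (fderiv ℝ τ y w) := by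
    filter_upwards [h1, h2] with y hy1 hy2
    rw [fderiv_comp y hy2 hy1]
    rfl
  have hdg : DifferentiableAt ℝ (fderiv ℝ g) (τ z) :=
    (contDiffAt_fderiv hg).differentiableAt (by simp)
  have hdτ : DifferentiableAt ℝ (fderiv ℝ τ) z := (contDiffAt_fderiv hτ).differentiableAt (by simp)
  have hdc : DifferentiableAt ℝ (fderiv ℝ (g ∘ τ)) z :=
    (contDiffAt_fderiv (hg.comp z hτ)).differentiableAt (by simp)
  have h4 : fderiv ℝ (fderiv ℝ (g ∘ τ)) z u w =
      fderiv ℝ g (τ z) (fderiv ℝ (fderiv ℝ τ) z u w) +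
        fderiv ℝ (fderiv ℝ g) (τ z) (fderiv ℝ τ z u) (fderiv ℝ τ z w) := by
    rw [← fderiv_clm_apply_const hdc, h3.fderiv_eq,
      fderiv_clm_apply_apply (c := fun y => fderiv ℝ g (τ y)) (hdg.comp z hτd)
        (hdτ.clm_apply (differentiableAt_const w)), fderiv_clm_apply_const hdτ]
    congr 1
    have := fderiv_comp z hdg hτd
    exact congrArg (fun L => L u (fderiv ℝ τ z w)) this
  have hn : normalProj (g ∘ τ) z = normalProj g (τ z) := by
    simp only [normalProj, tangentSpan_comp hg hτ hs]
  -- The term with D²τ lies in the image of dg and is killed by the normal projection.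
  rw [secondFF, secondFF, hn, h4, map_add, normalProj_eq]
  simp only [sub_apply, tangentProj_fderiv, ContinuousLinearMap.id_apply, sub_self, zero_add]

theorem IsTangentFrame.of_comp (hg : ContDiffAt ℝ ∞ g (τ z)) (hτ : ContDiffAt ℝ ∞ τ z)
    {e : Fin k → Euc k} (he : IsTangentFrame (g ∘ τ) z e) :
    IsTangentFrame g (τ z) fun i => fderiv ℝ τ z (e i) := by
  simp only [IsTangentFrame, fderiv_comp_reparam hg hτ] at he
  exact he

/-- Through orthonormal frames, which τ carries to orthonormal frames, no inverse Gram matrix has to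
be transformed. -/
theorem meanCurv_comp (hg : ContDiffAt ℝ ∞ g (τ z)) (hτ : ContDiffAt ℝ ∞ τ z)
    (hs : Function.Surjective (fderiv ℝ τ z)) {e : Fin k → Euc k}
    (he : IsTangentFrame (g ∘ τ) z e) : meanCurv (g ∘ τ) z = meanCurv g (τ z) := by
  rw [meanCurv_eq_of_isTangentFrame he, meanCurv_eq_of_isTangentFrame (he.of_comp hg hτ)]
  simp only [secondFF_comp hg hτ hs]

theorem tracelessFF_comp (hg : ContDiffAt ℝ ∞ g (τ z)) (hτ : ContDiffAt ℝ ∞ τ z)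
    (hs : Function.Surjective (fderiv ℝ τ z)) {e : Fin k → Euc k}
    (he : IsTangentFrame (g ∘ τ) z e) (u w : Euc k) :
    tracelessFF (g ∘ τ) z u w = tracelessFF g (τ z) (fderiv ℝ τ z u) (fderiv ℝ τ z w) := by
  rw [tracelessFF, tracelessFF, secondFF_comp hg hτ hs, meanCurv_comp hg hτ hs he,
    fderiv_comp_reparam hg hτ, fderiv_comp_reparam hg hτ]

end Reparametrization

/-- The equality is assumed at each point in the preferred chart of that very point. This invariance
brings it into a single chart on an open set, where it can be differentiated. -/
theorem IsWintgenAt.of_comp {g : Euc k → Euc (k + 2)} {τ : Euc k → Euc k} {z : Euc k}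
    (hg : ContDiffAt ℝ ∞ g (τ z)) (hτ : ContDiffAt ℝ ∞ τ z)
    (hs : Function.Surjective (fderiv ℝ τ z)) (h : IsWintgenAt (g ∘ τ) z) :
    IsWintgenAt g (τ z) := by
  obtain ⟨e, he, h⟩ := h
  refine ⟨_, he.of_comp hg hτ, fun ν hν => ?_⟩
  have hc (u w) : complexFF (g ∘ τ) z ν u w =
      complexFF g (τ z) ν (fderiv ℝ τ z u) (fderiv ℝ τ z w) := by
    rw [complexFF, complexFF, tracelessFF_comp hg hτ hs he]
  obtain ⟨h1, h2⟩ := h ν (by rwa [IsNormalFrame, tangentSpan_comp hg hτ hs])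
  simp only [hc] at h1 h2
  constructor
  · intro u v w x
    obtain ⟨u, rfl⟩ := hs u
    obtain ⟨v, rfl⟩ := hs v
    obtain ⟨w, rfl⟩ := hs w
    obtain ⟨x, rfl⟩ := hs x
    exact h1 u v w x
  · intro u w
    obtain ⟨u, rfl⟩ := hs u
    obtain ⟨w, rfl⟩ := hs w
    exact h2 u w

end Wintgen

end Submfd

namespace Submfd

/-! ### Complexified vectors and the bilinear product -/

section ComplexVectors

variable {n : ℕ}

/-- Real vectors as complex vectors. -/
noncomputable def cpx : Euc n →L[ℝ] (Fin n → ℂ) :=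
  ContinuousLinearMap.pi fun j => Complex.ofRealCLM.comp (EuclideanSpace.proj j)

theorem cpx_apply (v : Euc n) (j : Fin n) : cpx v j = (v j : ℂ) := rfl

theorem cpx_dotProduct_cpx (v w : Euc n) : cpx v ⬝ᵥ cpx w = ((inner ℝ v w : ℝ) : ℂ) := by
  simp [dotProduct, cpx_apply, PiLp.inner_apply, mul_comm]

theorem hasFDerivAt_dotProduct {E : Type*} [NormedAddCommGroup E] [NormedSpace ℝ E]
    {a b : E → Fin n → ℂ} {y : E} (ha : DifferentiableAt ℝ a y) (hb : DifferentiableAt ℝ b y)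
    (u : E) : fderiv ℝ (fun z => a z ⬝ᵥ b z) y u =
      a y ⬝ᵥ fderiv ℝ b y u + fderiv ℝ a y u ⬝ᵥ b y := by
  have h := HasFDerivAt.fun_sum (u := Finset.univ) fun (j : Fin n) _ =>
    (hasFDerivAt_pi'.mp ha.hasFDerivAt j).mul (hasFDerivAt_pi'.mp hb.hasFDerivAt j)
  have h2 : HasFDerivAt (fun z => a z ⬝ᵥ b z) _ y := h
  rw [h2.fderiv]
  simp only [sum_apply, dotProduct, ← Finset.sum_add_distrib]
  refine Finset.sum_congr rfl fun j _ => ?_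
  simp [mul_comm]

theorem dotProduct_deriv_eq_zero {E : Type*} [NormedAddCommGroup E] [NormedSpace ℝ E]
    {a b : E → Fin n → ℂ} {y : E} (ha : DifferentiableAt ℝ a y) (hb : DifferentiableAt ℝ b y)
    (h : ∀ᶠ z in nhds y, a z ⬝ᵥ b z = 0) (u : E) :
    a y ⬝ᵥ fderiv ℝ b y u + fderiv ℝ a y u ⬝ᵥ b y = 0 := by
  rw [← hasFDerivAt_dotProduct ha hb, Filter.EventuallyEq.fderiv_eq (f := fun _ => (0 : ℂ)) h,
    fderiv_fun_const]
  rfl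

end ComplexVectors

section Frame

variable {k : ℕ} {g : Euc k → Euc (k + 2)} {y : Euc k}

/-- Expansion of the complex bilinear product in an orthonormal frame. -/
theorem dotProduct_eq_sum_frame {e : Fin k → Euc k} {ν : Fin 2 → Euc (k + 2)}
    (he : IsTangentFrame g y e) (hν : IsNormalFrame g y ν) (a b : Fin (k + 2) → ℂ) :
    a ⬝ᵥ b = ∑ i, (a ⬝ᵥ cpx (fderiv ℝ g y (e i))) * (b ⬝ᵥ cpx (fderiv ℝ g y (e i))) +
      ((a ⬝ᵥ cpx (ν 0)) * (b ⬝ᵥ cpx (ν 0)) + (a ⬝ᵥ cpx (ν 1)) * (b ⬝ᵥ cpx (ν 1))) := by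
  -- The completeness relation of the orthonormal basis: it is real, so it also serves the complex
  -- bilinear product.
  have hδ (l j : Fin (k + 2)) : ∑ i, cpx (fderiv ℝ g y (e i)) l * cpx (fderiv ℝ g y (e i)) j +
      (cpx (ν 0) l * cpx (ν 0) j + cpx (ν 1) l * cpx (ν 1) j) = if l = j then 1 else 0 := by
    have h := inner_eq_sum_frame he hν (EuclideanSpace.single l 1) (EuclideanSpace.single j 1)
    simp only [EuclideanSpace.inner_single_right, one_mul, conj_trivial, PiLp.single_apply] at h
    simp only [cpx_apply]
    have h := congrArg (fun t : ℝ => (t : ℂ)) h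
    push_cast at h
    rw [← h]
    by_cases hlj : l = j
    · simp [hlj]
    · simp [hlj, Ne.symm hlj]
  have hp (v : Fin (k + 2) → ℂ) : (a ⬝ᵥ v) * (b ⬝ᵥ v) =
      ∑ l, ∑ j, a l * b j * (v l * v j) := by
    simp only [dotProduct, Finset.sum_mul_sum]
    exact Finset.sum_congr rfl fun l _ => Finset.sum_congr rfl fun j _ => by ring
  simp only [hp]
  rw [Finset.sum_comm]
  have hc (l : Fin (k + 2)) : ∑ i, ∑ j, a l * b j * (cpx (fderiv ℝ g y (e i)) l *
      cpx (fderiv ℝ g y (e i)) j) = ∑ j, a l * b j * ∑ i, (cpx (fderiv ℝ g y (e i)) l *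
      cpx (fderiv ℝ g y (e i)) j) := by
    rw [Finset.sum_comm]
    simp only [Finset.mul_sum]
  simp only [hc, ← Finset.sum_add_distrib, ← mul_add, hδ]
  simp [dotProduct]

theorem eq_zero_of_dotProduct_frame {e : Fin k → Euc k} {ν : Fin 2 → Euc (k + 2)}
    (he : IsTangentFrame g y e) (hν : IsNormalFrame g y ν) {a : Fin (k + 2) → ℂ}
    (ht : ∀ i, a ⬝ᵥ cpx (fderiv ℝ g y (e i)) = 0) (h0 : a ⬝ᵥ cpx (ν 0) = 0)
    (h1 : a ⬝ᵥ cpx (ν 1) = 0) : a = 0 := by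
  funext j
  have h := dotProduct_eq_sum_frame he hν a (Pi.single j 1)
  simpa [ht, h0, h1] using h

end Frame

/-! ### Smoothness of the mean curvature and of the complex center -/

section Smoothness

variable {k n : ℕ} {g : Euc k → Euc n} {y : Euc k}

theorem contDiffAt_normalProj (hg : ContDiffAt ℝ ∞ g y) (h : Function.Injective (fderiv ℝ g y)) :
    ContDiffAt ℝ ∞ (normalProj g) y := by
  have : normalProj g = fun z => ContinuousLinearMap.id ℝ (Euc n) - tangentProj g z := by
    funext z; exact normalProj_eq
  rw [this]
  exact contDiffAt_const.sub (contDiffAt_tangentProj hg h)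

theorem contDiffAt_secondFF (hg : ContDiffAt ℝ ∞ g y) (h : Function.Injective (fderiv ℝ g y))
    (u v : Euc k) : ContDiffAt ℝ ∞ (fun z => secondFF g z u v) y :=
  (contDiffAt_normalProj hg h).clm_apply
    (((contDiffAt_fderiv hg).fderiv_right (m := ∞) (by simp)).clm_apply contDiffAt_const |>.clm_apply
      contDiffAt_const)

theorem contDiffAt_meanCurv (hg : ContDiffAt ℝ ∞ g y) (h : Function.Injective (fderiv ℝ g y)) :
    ContDiffAt ℝ ∞ (meanCurv g) y :=
  (ContDiffAt.sum fun i _ => ContDiffAt.sum fun j _ =>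
    (contDiffAt_gram_inv hg h i j).smul (contDiffAt_secondFF hg h _ _)).const_smul (k : ℝ)⁻¹

/-- The complex mean curvature `⟨H, ν 0⟩ - i ⟨H, ν 1⟩`. -/
noncomputable def complexMeanCurv (g : Euc k → Euc n) (y : Euc k) (ν : Fin 2 → Euc n) : ℂ :=
  (inner ℝ (meanCurv g y) (ν 0) : ℝ) - Complex.I * (inner ℝ (meanCurv g y) (ν 1) : ℝ)

/-- The isotropic normal vector `ν 0 - i ν 1`. -/
noncomputable def complexNormal (ν : Fin 2 → Euc n) : Fin n → ℂ :=
  cpx (ν 0) - Complex.I • cpx (ν 1)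

/-- The complex center `g + (ν 0 - i ν 1) / (⟨H, ν 0⟩ - i ⟨H, ν 1⟩)`. -/
noncomputable def localCenter (g : Euc k → Euc n) (ν : Euc k → Fin 2 → Euc n) (y : Euc k) :
    Fin n → ℂ :=
  cpx (g y) + (complexMeanCurv g y (ν y))⁻¹ • complexNormal (ν y)

theorem contDiffAt_complexMeanCurv (hg : ContDiffAt ℝ ∞ g y)
    (h : Function.Injective (fderiv ℝ g y)) {ν : Euc k → Fin 2 → Euc n}
    (hν : ∀ a, ContDiffAt ℝ ∞ (fun z => ν z a) y) :
    ContDiffAt ℝ ∞ (fun z => complexMeanCurv g z (ν z)) y := by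
  have h1 (a) : ContDiffAt ℝ ∞ (fun z => ((inner ℝ (meanCurv g z) (ν z a) : ℝ) : ℂ)) y :=
    Complex.ofRealCLM.contDiff.contDiffAt.comp y ((contDiffAt_meanCurv hg h).inner ℝ (hν a))
  exact (h1 0).sub (contDiffAt_const.mul (h1 1))

theorem contDiffAt_complexNormal {ν : Euc k → Fin 2 → Euc n}
    (hν : ∀ a, ContDiffAt ℝ ∞ (fun z => ν z a) y) :
    ContDiffAt ℝ ∞ (fun z => complexNormal (ν z)) y :=
  (cpx.contDiff.contDiffAt.comp y (hν 0)).sub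
    ((cpx.contDiff.contDiffAt.comp y (hν 1)).const_smul Complex.I)

theorem contDiffAt_localCenter (hg : ContDiffAt ℝ ∞ g y)
    (h : Function.Injective (fderiv ℝ g y)) {ν : Euc k → Fin 2 → Euc n}
    (hν : ∀ a, ContDiffAt ℝ ∞ (fun z => ν z a) y) (h0 : complexMeanCurv g y (ν y) ≠ 0) :
    ContDiffAt ℝ ∞ (localCenter g ν) y :=
  (cpx.contDiff.contDiffAt.comp y hg).add
    (((contDiffAt_complexMeanCurv hg h hν).inv h0).smul (contDiffAt_complexNormal hν))

end Smoothness

/-! ### The isotropic normal vector and the complex mean curvature -/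

section Codazzi

variable {k : ℕ} {g : Euc k → Euc (k + 2)} {y : Euc k}

theorem complexNormal_dotProduct_cpx {n : ℕ} (ν : Fin 2 → Euc n) (w : Euc n) :
    complexNormal ν ⬝ᵥ cpx w = (inner ℝ (ν 0) w : ℝ) - Complex.I * (inner ℝ (ν 1) w : ℝ) := by
  simp only [complexNormal, sub_dotProduct, smul_dotProduct, cpx_dotProduct_cpx, smul_eq_mul]

theorem dotProduct_complexNormal {n : ℕ} (ν : Fin 2 → Euc n) (w : Fin n → ℂ) :
    w ⬝ᵥ complexNormal ν = w ⬝ᵥ cpx (ν 0) - Complex.I * (w ⬝ᵥ cpx (ν 1)) := by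
  simp only [complexNormal, dotProduct_sub, dotProduct_smul, smul_eq_mul]

theorem complexNormal_dotProduct_self {ν : Fin 2 → Euc (k + 2)} (hν : IsNormalFrame g y ν) :
    complexNormal ν ⬝ᵥ complexNormal ν = 0 := by
  have h := orthonormal_iff_ite.mp hν.1
  rw [dotProduct_complexNormal, complexNormal_dotProduct_cpx, complexNormal_dotProduct_cpx,
    h, h, h, h]
  simp only [if_true, zero_ne_one, one_ne_zero, if_false, Complex.ofReal_one, Complex.ofReal_zero]
  linear_combination Complex.I_sq

theorem complexMeanCurv_ne_zero {e : Fin k → Euc k} {ν : Fin 2 → Euc (k + 2)}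
    (he : IsTangentFrame g y e) (hν : IsNormalFrame g y ν) (hH : meanCurv g y ≠ 0) :
    complexMeanCurv g y ν ≠ 0 := by
  intro h0
  apply hH
  rw [complexMeanCurv, Complex.ext_iff] at h0
  simp only [Complex.sub_re, Complex.ofReal_re, Complex.mul_re, Complex.I_re, zero_mul,
    Complex.I_im, Complex.ofReal_im, mul_zero, sub_zero, Complex.zero_re, Complex.sub_im,
    Complex.mul_im, one_mul, zero_add, zero_sub, neg_eq_zero, Complex.zero_im,
    real_inner_comm (ν _)] at h0
  rw [← inner_self_eq_zero (𝕜 := ℝ), inner_eq_of_mem_orthogonal he hν meanCurv_mem]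
  rw [h0.1, h0.2]
  ring

end Codazzi

end Submfd

namespace Submfd

/-! ### The derivative of the complex center -/

section FramedWintgen

/-- A piece of a Wintgen ideal submanifold of codimension two without minimal points, with a smooth
orthonormal normal frame. -/
structure IsFramedWintgen {k : ℕ} (g : Euc k → Euc (k + 2)) (ν : Euc k → Fin 2 → Euc (k + 2))
    (O : Set (Euc k)) : Prop where
  isOpen : IsOpen O
  contDiffAt : ∀ z ∈ O, ContDiffAt ℝ ∞ g z
  injective : ∀ z ∈ O, Function.Injective (fderiv ℝ g z)
  isWintgenAt : ∀ z ∈ O, IsWintgenAt g z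
  contDiffAt_normal : ∀ z ∈ O, ∀ a, ContDiffAt ℝ ∞ (fun y => ν y a) z
  isNormalFrame : ∀ z ∈ O, IsNormalFrame g z (ν z)
  meanCurv_ne_zero : ∀ z ∈ O, meanCurv g z ≠ 0

namespace IsFramedWintgen

variable {k : ℕ} {g : Euc k → Euc (k + 2)} {O : Set (Euc k)} {ν : Euc k → Fin 2 → Euc (k + 2)}
  {z : Euc k}

theorem complexMeanCurv_ne_zero (h : IsFramedWintgen g ν O) (hz : z ∈ O) :
    complexMeanCurv g z (ν z) ≠ 0 := by
  obtain ⟨e, he, -⟩ := h.isWintgenAt z hz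
  exact Submfd.complexMeanCurv_ne_zero he (h.isNormalFrame z hz) (h.meanCurv_ne_zero z hz)

theorem contDiffAt_localCenter (h : IsFramedWintgen g ν O) (hz : z ∈ O) :
    ContDiffAt ℝ ∞ (localCenter g ν) z :=
  Submfd.contDiffAt_localCenter (h.contDiffAt z hz) (h.injective z hz) (h.contDiffAt_normal z hz)
    (h.complexMeanCurv_ne_zero hz)

theorem differentiableAt_complexNormal (h : IsFramedWintgen g ν O) (hz : z ∈ O) :
    DifferentiableAt ℝ (fun y => complexNormal (ν y)) z :=
  (contDiffAt_complexNormal (h.contDiffAt_normal z hz)).differentiableAt (by simp)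

theorem fderiv_localCenter (h : IsFramedWintgen g ν O) (hz : z ∈ O) (u : Euc k) :
    fderiv ℝ (localCenter g ν) z u = cpx (fderiv ℝ g z u) +
      ((complexMeanCurv g z (ν z))⁻¹ • fderiv ℝ (fun y => complexNormal (ν y)) z u +
        fderiv ℝ (fun y => (complexMeanCurv g y (ν y))⁻¹) z u • complexNormal (ν z)) := by
  have hΛ : DifferentiableAt ℝ (fun y => (complexMeanCurv g y (ν y))⁻¹) z :=
    ((contDiffAt_complexMeanCurv (h.contDiffAt z hz) (h.injective z hz)
      (h.contDiffAt_normal z hz)).inv (h.complexMeanCurv_ne_zero hz)).differentiableAt (by simp)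
  have hN := h.differentiableAt_complexNormal hz
  have hg : DifferentiableAt ℝ g z := (h.contDiffAt z hz).differentiableAt (by simp)
  have h1 := (cpx.hasFDerivAt.comp z hg.hasFDerivAt).add (hΛ.hasFDerivAt.smul hN.hasFDerivAt)
  have h2 : HasFDerivAt (localCenter g ν) _ z := h1
  rw [h2.fderiv]
  rfl

theorem eventually_mem (h : IsFramedWintgen g ν O) (hz : z ∈ O) : ∀ᶠ y in nhds z, y ∈ O :=
  h.isOpen.mem_nhds hz

theorem complexNormal_dotProduct_fderiv (h : IsFramedWintgen g ν O) (hz : z ∈ O) (u : Euc k) :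
    complexNormal (ν z) ⬝ᵥ cpx (fderiv ℝ g z u) = 0 := by
  rw [complexNormal_dotProduct_cpx, real_inner_comm, real_inner_comm _ (ν z 1),
    inner_fderiv_of_mem_orthogonal ((h.isNormalFrame z hz).2 0),
    inner_fderiv_of_mem_orthogonal ((h.isNormalFrame z hz).2 1)]
  simp

theorem fderiv_complexNormal_dotProduct (h : IsFramedWintgen g ν O) (hz : z ∈ O) (u : Euc k) :
    fderiv ℝ (fun y => complexNormal (ν y)) z u ⬝ᵥ complexNormal (ν z) = 0 := by
  have hN := h.differentiableAt_complexNormal hz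
  have := dotProduct_deriv_eq_zero hN hN ((h.eventually_mem hz).mono fun y hy =>
    complexNormal_dotProduct_self (h.isNormalFrame y hy)) u
  rw [dotProduct_comm, ← two_mul] at this
  simpa using this

/-- The Weingarten equation: differentiate N · dg(w) = 0 and split the second fundamental form into
its traceless part and its trace. -/
theorem fderiv_complexNormal_dotProduct_fderiv (h : IsFramedWintgen g ν O) (hz : z ∈ O)
    (u w : Euc k) : fderiv ℝ (fun y => complexNormal (ν y)) z u ⬝ᵥ cpx (fderiv ℝ g z w) =
      - (complexFF g z (ν z) u w + (inner ℝ (fderiv ℝ g z u) (fderiv ℝ g z w) : ℝ) *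
        complexMeanCurv g z (ν z)) := by
  have hN := h.differentiableAt_complexNormal hz
  have hdg : DifferentiableAt ℝ (fderiv ℝ g) z :=
    (contDiffAt_fderiv (h.contDiffAt z hz)).differentiableAt (by simp)
  have hgw : DifferentiableAt ℝ (fun y => cpx (fderiv ℝ g y w)) z :=
    cpx.differentiableAt.comp z (hdg.clm_apply (differentiableAt_const w))
  have h1 := dotProduct_deriv_eq_zero hN hgw ((h.eventually_mem hz).mono fun y hy =>
    h.complexNormal_dotProduct_fderiv hy w) u
  have h2 : fderiv ℝ (fun y => cpx (fderiv ℝ g y w)) z u = cpx (fderiv ℝ (fderiv ℝ g) z u w) := by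
    rw [fderiv_clm_apply_apply (c := fun _ => cpx) (differentiableAt_const _)
      (hdg.clm_apply (differentiableAt_const w)), fderiv_clm_apply_const hdg, fderiv_fun_const]
    simp
  have h3 (a : Fin 2) : inner ℝ (ν z a) (fderiv ℝ (fderiv ℝ g) z u w) =
      inner ℝ (ν z a) (tracelessFF g z u w) +
        inner ℝ (fderiv ℝ g z u) (fderiv ℝ g z w) * inner ℝ (meanCurv g z) (ν z a) := by
    have hs : inner ℝ (ν z a) (secondFF g z u w) = inner ℝ (ν z a) (fderiv ℝ (fderiv ℝ g) z u w) := by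
      rw [secondFF, normalProj_eq, sub_apply, inner_sub_right, ← inner_tangentProj,
        tangentProj_eq_zero ((h.isNormalFrame z hz).2 a)]
      simp
    rw [tracelessFF, inner_sub_right, hs, real_inner_smul_right, real_inner_comm (ν z a)]
    ring
  rw [h2, complexNormal_dotProduct_cpx, h3, h3] at h1
  rw [complexFF, complexMeanCurv]
  push_cast at h1
  linear_combination h1

theorem fderiv_localCenter_dotProduct_complexNormal (h : IsFramedWintgen g ν O) (hz : z ∈ O)
    (u : Euc k) : fderiv ℝ (localCenter g ν) z u ⬝ᵥ complexNormal (ν z) = 0 := by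
  rw [h.fderiv_localCenter hz, add_dotProduct, add_dotProduct, smul_dotProduct, smul_dotProduct,
    h.fderiv_complexNormal_dotProduct hz, complexNormal_dotProduct_self (h.isNormalFrame z hz),
    dotProduct_comm, h.complexNormal_dotProduct_fderiv hz]
  simp

/-- The factor Λ⁻¹ in the center is chosen for this: the trace part of Λ⁻¹ dN cancels dg, and only
the traceless form survives. -/
theorem fderiv_localCenter_dotProduct_fderiv (h : IsFramedWintgen g ν O) (hz : z ∈ O)
    (u w : Euc k) : fderiv ℝ (localCenter g ν) z u ⬝ᵥ cpx (fderiv ℝ g z w) =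
      - (complexMeanCurv g z (ν z))⁻¹ * complexFF g z (ν z) u w := by
  rw [h.fderiv_localCenter hz, add_dotProduct, add_dotProduct, smul_dotProduct, smul_dotProduct,
    h.fderiv_complexNormal_dotProduct_fderiv hz, cpx_dotProduct_cpx,
    h.complexNormal_dotProduct_fderiv hz, smul_eq_mul, smul_eq_mul]
  have := h.complexMeanCurv_ne_zero hz
  field_simp
  ring

end IsFramedWintgen

/-- The tangential part of the derivative of the complex center. -/
noncomputable def tangentialDeriv {k : ℕ} (g : Euc k → Euc (k + 2))
    (ν : Euc k → Fin 2 → Euc (k + 2)) (u z : Euc k) : Fin (k + 2) → ℂ :=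
  fderiv ℝ (localCenter g ν) z u -
    (fderiv ℝ (localCenter g ν) z u ⬝ᵥ cpx (ν z 0)) • complexNormal (ν z)

namespace IsFramedWintgen

variable {k : ℕ} {g : Euc k → Euc (k + 2)} {O : Set (Euc k)} {ν : Euc k → Fin 2 → Euc (k + 2)}
  {z : Euc k}

/-- Since dX · N = 0, the component of dX along ν₁ is -i times the one along ν₀. So the normal part
of dX is (dX · ν₀) N, which is what `tangentialDeriv` removes. -/
theorem tangentialDeriv_dotProduct_normal (h : IsFramedWintgen g ν O) (hz : z ∈ O) (u : Euc k)
    (a : Fin 2) : tangentialDeriv g ν u z ⬝ᵥ cpx (ν z a) = 0 := by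
  have ho := orthonormal_iff_ite.mp (h.isNormalFrame z hz).1
  have h1 := h.fderiv_localCenter_dotProduct_complexNormal hz u
  rw [dotProduct_complexNormal] at h1
  rw [tangentialDeriv, sub_dotProduct, smul_dotProduct, complexNormal_dotProduct_cpx, ho, ho,
    smul_eq_mul]
  fin_cases a
  · simp
  · simp
    linear_combination Complex.I * h1 + fderiv ℝ (localCenter g ν) z u ⬝ᵥ cpx (ν z 1) *
      Complex.I_sq

theorem tangentialDeriv_dotProduct_complexNormal (h : IsFramedWintgen g ν O) (hz : z ∈ O)
    (u : Euc k) : tangentialDeriv g ν u z ⬝ᵥ complexNormal (ν z) = 0 := by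
  rw [dotProduct_complexNormal, h.tangentialDeriv_dotProduct_normal hz,
    h.tangentialDeriv_dotProduct_normal hz, mul_zero, sub_zero]

theorem tangentialDeriv_dotProduct_fderiv (h : IsFramedWintgen g ν O) (hz : z ∈ O)
    (u w : Euc k) : tangentialDeriv g ν u z ⬝ᵥ cpx (fderiv ℝ g z w) =
      - (complexMeanCurv g z (ν z))⁻¹ * complexFF g z (ν z) u w := by
  rw [tangentialDeriv, sub_dotProduct, smul_dotProduct, h.complexNormal_dotProduct_fderiv hz,
    smul_zero, sub_zero, h.fderiv_localCenter_dotProduct_fderiv hz]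

/-- In a tangent frame this product is Λ⁻² times an entry of C², which vanishes. -/
theorem tangentialDeriv_dotProduct_tangentialDeriv (h : IsFramedWintgen g ν O) (hz : z ∈ O)
    (u w : Euc k) : tangentialDeriv g ν u z ⬝ᵥ tangentialDeriv g ν w z = 0 := by
  obtain ⟨e, he, h1⟩ := h.isWintgenAt z hz
  have h2 := (h1 (ν z) (h.isNormalFrame z hz)).2 u w
  rw [dotProduct_eq_sum_frame he (h.isNormalFrame z hz)]
  simp only [h.tangentialDeriv_dotProduct_normal hz, h.tangentialDeriv_dotProduct_fderiv hz,
    mul_zero, add_zero]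
  have (i : Fin k) : -(complexMeanCurv g z (ν z))⁻¹ * complexFF g z (ν z) u (e i) *
      (-(complexMeanCurv g z (ν z))⁻¹ * complexFF g z (ν z) w (e i)) =
      (complexMeanCurv g z (ν z))⁻¹ ^ 2 *
        (complexFF g z (ν z) u (e i) * complexFF g z (ν z) w (e i)) := by ring
  simp only [this, ← Finset.mul_sum, h2, mul_zero]

/-- The minors of C vanish, so all tangential parts are proportional. -/
theorem smul_tangentialDeriv (h : IsFramedWintgen g ν O) (hz : z ∈ O) (u v : Euc k) :
    complexFF g z (ν z) v v • tangentialDeriv g ν u z =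
      complexFF g z (ν z) u v • tangentialDeriv g ν v z := by
  obtain ⟨e, he, h1⟩ := h.isWintgenAt z hz
  have h2 := (h1 (ν z) (h.isNormalFrame z hz)).1
  rw [← sub_eq_zero]
  refine eq_zero_of_dotProduct_frame he (h.isNormalFrame z hz) (fun i => ?_) ?_ ?_
  · rw [sub_dotProduct, smul_dotProduct, smul_dotProduct, h.tangentialDeriv_dotProduct_fderiv hz,
      h.tangentialDeriv_dotProduct_fderiv hz, smul_eq_mul, smul_eq_mul]
    linear_combination (complexMeanCurv g z (ν z))⁻¹ * h2 u v v (e i)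
  all_goals
    rw [sub_dotProduct, smul_dotProduct, smul_dotProduct, h.tangentialDeriv_dotProduct_normal hz,
      h.tangentialDeriv_dotProduct_normal hz, smul_zero, smul_zero, sub_zero]

theorem fderiv_localCenter_eq (u : Euc k) : fderiv ℝ (localCenter g ν) z u =
    tangentialDeriv g ν u z +
      (fderiv ℝ (localCenter g ν) z u ⬝ᵥ cpx (ν z 0)) • complexNormal (ν z) := by
  rw [tangentialDeriv, sub_add_cancel]

theorem fderiv_localCenter_dotProduct_tangentialDeriv (h : IsFramedWintgen g ν O) (hz : z ∈ O)
    (u w : Euc k) : fderiv ℝ (localCenter g ν) z u ⬝ᵥ tangentialDeriv g ν w z = 0 := by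
  rw [fderiv_localCenter_eq, add_dotProduct, smul_dotProduct,
    h.tangentialDeriv_dotProduct_tangentialDeriv hz, dotProduct_comm (complexNormal _),
    h.tangentialDeriv_dotProduct_complexNormal hz, smul_zero, add_zero]

theorem differentiableAt_fderiv_localCenter (h : IsFramedWintgen g ν O) (hz : z ∈ O) :
    DifferentiableAt ℝ (fderiv ℝ (localCenter g ν)) z :=
  ((h.contDiffAt_localCenter hz).fderiv_right (m := ∞) (by simp)).differentiableAt (by simp)

theorem differentiableAt_tangentialDeriv (h : IsFramedWintgen g ν O) (hz : z ∈ O) (u : Euc k) :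
    DifferentiableAt ℝ (tangentialDeriv g ν u) z := by
  have h1 : DifferentiableAt ℝ (fun y => fderiv ℝ (localCenter g ν) y u) z :=
    (h.differentiableAt_fderiv_localCenter hz).clm_apply (differentiableAt_const u)
  have h2 : DifferentiableAt ℝ (fun y => cpx (ν y 0)) z :=
    cpx.differentiableAt.comp z ((h.contDiffAt_normal z hz 0).differentiableAt (by simp))
  have h3 : DifferentiableAt ℝ
      (fun y => fderiv ℝ (localCenter g ν) y u ⬝ᵥ cpx (ν y 0)) z := by
    simp only [dotProduct]
    exact DifferentiableAt.fun_sum fun j _ =>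
      (differentiableAt_pi.mp h1 j).mul (differentiableAt_pi.mp h2 j)
  exact h1.sub (h3.smul (h.differentiableAt_complexNormal hz))

/-- The Codazzi equation, in the form that it takes for the complex center. -/
theorem normal_component_symm (h : IsFramedWintgen g ν O) (hz : z ∈ O) {v : Euc k}
    (hv : complexFF g z (ν z) v v ≠ 0) (u w : Euc k) :
    (fderiv ℝ (localCenter g ν) z u ⬝ᵥ cpx (ν z 0)) * complexFF g z (ν z) v w =
      (fderiv ℝ (localCenter g ν) z w ⬝ᵥ cpx (ν z 0)) * complexFF g z (ν z) v u := by
  have hX := h.differentiableAt_fderiv_localCenter hz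
  have hT := h.differentiableAt_tangentialDeriv hz v
  have hN := h.differentiableAt_complexNormal hz
  have hsymm : fderiv ℝ (fderiv ℝ (localCenter g ν)) z u w =
      fderiv ℝ (fderiv ℝ (localCenter g ν)) z w u :=
    ((h.contDiffAt_localCenter hz).isSymmSndFDerivAt (by simpa using two_le_infty)).eq u w
  -- Write T for the tangential part of dX. Differentiating dX(u) · T(v) = 0 along w shows that
  -- dX(u) · ∂_w T(v) is symmetric in u and w, because D²X is.
  have h1 (u w : Euc k) : fderiv ℝ (localCenter g ν) z u ⬝ᵥ fderiv ℝ (tangentialDeriv g ν v) z w +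
      fderiv ℝ (fderiv ℝ (localCenter g ν)) z w u ⬝ᵥ tangentialDeriv g ν v z = 0 := by
    rw [← fderiv_clm_apply_const hX]
    exact dotProduct_deriv_eq_zero (hX.clm_apply (differentiableAt_const u)) hT
      ((h.eventually_mem hz).mono fun y hy =>
        h.fderiv_localCenter_dotProduct_tangentialDeriv hy u v) w
  have h2 (w : Euc k) :
      tangentialDeriv g ν v z ⬝ᵥ fderiv ℝ (tangentialDeriv g ν v) z w = 0 := by
    have := dotProduct_deriv_eq_zero hT hT ((h.eventually_mem hz).mono fun y hy =>
      h.tangentialDeriv_dotProduct_tangentialDeriv hy v v) w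
    rw [dotProduct_comm (fderiv ℝ (tangentialDeriv g ν v) z w), ← two_mul] at this
    simpa using this
  -- As T(u) is a multiple of T(v), isotropy of T(v) suffices. This is where C(v, v) ≠ 0 enters.
  have h3 (u w : Euc k) :
      tangentialDeriv g ν u z ⬝ᵥ fderiv ℝ (tangentialDeriv g ν v) z w = 0 := by
    have := congrArg (fun t => t ⬝ᵥ fderiv ℝ (tangentialDeriv g ν v) z w)
      (h.smul_tangentialDeriv hz u v)
    simp only [smul_dotProduct, h2, smul_zero] at this
    exact (smul_eq_zero.mp this).resolve_left hv
  -- Moving the derivative from T(v) to N leaves -T(v) · ∂_w N. Expanding dX(w) in dX(w) · T(v) = 0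
  -- identifies T(v) · ∂_w N with C(v, w).
  have h4 (w : Euc k) : complexNormal (ν z) ⬝ᵥ fderiv ℝ (tangentialDeriv g ν v) z w =
      - complexFF g z (ν z) v w := by
    have h5 := dotProduct_deriv_eq_zero hT hN ((h.eventually_mem hz).mono fun y hy =>
      h.tangentialDeriv_dotProduct_complexNormal hy v) w
    have h6 := h.fderiv_localCenter_dotProduct_tangentialDeriv hz w v
    rw [h.fderiv_localCenter hz, add_dotProduct, add_dotProduct, smul_dotProduct, smul_dotProduct,
      dotProduct_comm (cpx _), h.tangentialDeriv_dotProduct_fderiv hz,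
      dotProduct_comm (complexNormal _), h.tangentialDeriv_dotProduct_complexNormal hz,
      smul_eq_mul, smul_eq_mul, mul_zero, add_zero, dotProduct_comm] at h6
    have h7 := h.complexMeanCurv_ne_zero hz
    have h8 : tangentialDeriv g ν v z ⬝ᵥ fderiv ℝ (fun y => complexNormal (ν y)) z w =
        complexFF g z (ν z) v w := by
      field_simp at h6
      linear_combination h6
    rw [h8, dotProduct_comm] at h5
    linear_combination h5
  have h9 (u w : Euc k) : fderiv ℝ (localCenter g ν) z u ⬝ᵥ
      fderiv ℝ (tangentialDeriv g ν v) z w =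
      - (fderiv ℝ (localCenter g ν) z u ⬝ᵥ cpx (ν z 0)) * complexFF g z (ν z) v w := by
    conv_lhs => rw [fderiv_localCenter_eq, add_dotProduct, smul_dotProduct, h3, h4, smul_eq_mul]
    ring
  have h10 := h1 u w
  have h11 := h1 w u
  rw [h9] at h10 h11
  rw [hsymm] at h11
  linear_combination h11 - h10

/-- The derivative of the complex center has complex rank one. -/
theorem smul_fderiv_localCenter (h : IsFramedWintgen g ν O) (hz : z ∈ O) {v : Euc k}
    (hv : complexFF g z (ν z) v v ≠ 0) (u : Euc k) :
    complexFF g z (ν z) v v • fderiv ℝ (localCenter g ν) z u =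
      complexFF g z (ν z) v u • fderiv ℝ (localCenter g ν) z v := by
  have h1 := h.normal_component_symm hz hv u v
  have h2 := h.smul_tangentialDeriv hz u v
  rw [complexFF_symm (h.contDiffAt z hz) _ u v] at h2
  rw [fderiv_localCenter_eq u, fderiv_localCenter_eq v, smul_add, smul_add, h2, smul_smul,
    smul_smul, mul_comm, h1, mul_comm (fderiv ℝ (localCenter g ν) z v ⬝ᵥ _)]

/-- With C(v, v) ≠ 0, take φ = C(v, ·) and ξ = dX(v) / C(v, v). The vector ξ is isotropic because
both parts of dX(v) are isotropic and mutually orthogonal. -/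
theorem exists_fderiv_localCenter_eq (h : IsFramedWintgen g ν O) (hz : z ∈ O)
    (hu : ∃ u w, tracelessFF g z u w ≠ 0) :
    ∃ (φ : Euc k → ℂ) (ξ : Fin (k + 2) → ℂ), Function.Surjective φ ∧ ξ ≠ 0 ∧ ξ ⬝ᵥ ξ = 0 ∧
      ∀ u, fderiv ℝ (localCenter g ν) z u = φ u • ξ := by
  obtain ⟨v, hv⟩ := (h.isWintgenAt z hz).exists_complexFF_ne_zero (h.contDiffAt z hz)
    (h.isNormalFrame z hz) hu
  refine ⟨fun u => complexFF g z (ν z) v u,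
    (complexFF g z (ν z) v v)⁻¹ • fderiv ℝ (localCenter g ν) z v, ?_, ?_, ?_, fun u => ?_⟩
  · obtain ⟨e, he, h1⟩ := h.isWintgenAt z hz
    have h2 := (h1 (ν z) (h.isNormalFrame z hz)).2 v v
    set c : Fin k → ℂ := fun i => complexFF g z (ν z) v (e i) with hc
    have hlin (a : Fin k → ℝ) : complexFF g z (ν z) v (∑ i, a i • e i) = ∑ i, (a i : ℂ) * c i := by
      rw [complexFF_symm (h.contDiffAt z hz), complexFF_sum_smul_left]
      exact Finset.sum_congr rfl fun i _ => by rw [complexFF_symm (h.contDiffAt z hz)]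
    -- Σ cᵢ² = 0 says that Re c and Im c have equal length and are orthogonal.
    have hre : ∑ i, ((c i).re ^ 2 - (c i).im ^ 2) = 0 := by
      have := congrArg Complex.re h2
      rw [Complex.re_sum] at this
      rw [← Complex.zero_re, ← this]
      exact Finset.sum_congr rfl fun i _ => by rw [Complex.mul_re]; ring
    have him : ∑ i, (c i).re * (c i).im = 0 := by
      have := congrArg Complex.im h2
      rw [Complex.im_sum] at this
      have h3 : ∑ i, (complexFF g z (ν z) v (e i) * complexFF g z (ν z) v (e i)).im =
          2 * ∑ i, (c i).re * (c i).im := by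
        rw [Finset.mul_sum]
        exact Finset.sum_congr rfl fun i _ => by rw [Complex.mul_im]; ring
      rw [h3, Complex.zero_im] at this
      linarith
    set ρ := ∑ i, (c i).re ^ 2 with hρ
    have hρ2 : ∑ i, (c i).im ^ 2 = ρ := by
      rw [Finset.sum_sub_distrib] at hre
      linarith
    have hρ0 : ρ ≠ 0 := by
      intro h0
      apply hv
      obtain ⟨a, ha⟩ := eq_sum_tangentFrame he v
      have h3 := hlin a
      rw [← ha] at h3
      rw [h3]
      refine Finset.sum_eq_zero fun i _ => ?_
      have hr := (Finset.sum_eq_zero_iff_of_nonneg fun i _ => sq_nonneg _).mp h0 i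
        (Finset.mem_univ i)
      have hi := (Finset.sum_eq_zero_iff_of_nonneg fun i _ => sq_nonneg _).mp (hρ2.trans h0) i
        (Finset.mem_univ i)
      have hci : c i = 0 := Complex.ext (pow_eq_zero_iff two_ne_zero |>.mp hr)
        (pow_eq_zero_iff two_ne_zero |>.mp hi)
      rw [hci, mul_zero]
    intro t
    -- Re c and Im c are orthogonal with squared length ρ, so this combination of them, divided by
    -- ρ, is mapped to t.
    refine ⟨∑ i, ((t.re * (c i).re + t.im * (c i).im) / ρ) • e i, ?_⟩
    simp only [hlin]
    have e1 : ∑ i, (t.re * (c i).re + t.im * (c i).im) / ρ * (c i).re = t.re := by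
      have : ∀ i, (t.re * (c i).re + t.im * (c i).im) / ρ * (c i).re =
          t.re / ρ * (c i).re ^ 2 + t.im / ρ * ((c i).re * (c i).im) := fun i => by ring
      simp only [this, Finset.sum_add_distrib, ← Finset.mul_sum, him, ← hρ]
      field_simp
      ring
    have e2 : ∑ i, (t.re * (c i).re + t.im * (c i).im) / ρ * (c i).im = t.im := by
      have : ∀ i, (t.re * (c i).re + t.im * (c i).im) / ρ * (c i).im =
          t.re / ρ * ((c i).re * (c i).im) + t.im / ρ * (c i).im ^ 2 := fun i => by ring
      simp only [this, Finset.sum_add_distrib, ← Finset.mul_sum, him, hρ2]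
      field_simp
      ring
    apply Complex.ext
    · rw [Complex.re_sum]
      simp only [Complex.re_ofReal_mul, e1]
    · rw [Complex.im_sum]
      simp only [Complex.im_ofReal_mul, e2]
  · intro h0
    have h1 := h.fderiv_localCenter_dotProduct_fderiv hz v v
    rw [(smul_eq_zero.mp h0).resolve_left (inv_ne_zero hv), zero_dotProduct] at h1
    exact mul_ne_zero (neg_ne_zero.mpr (inv_ne_zero (h.complexMeanCurv_ne_zero hz))) hv h1.symm
  · have : fderiv ℝ (localCenter g ν) z v ⬝ᵥ fderiv ℝ (localCenter g ν) z v = 0 := by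
      conv_lhs =>
        rw [fderiv_localCenter_eq v, add_dotProduct, dotProduct_add, dotProduct_add]
      simp only [dotProduct_smul, smul_dotProduct, h.tangentialDeriv_dotProduct_tangentialDeriv hz,
        dotProduct_comm (complexNormal _) (tangentialDeriv _ _ _ _),
        h.tangentialDeriv_dotProduct_complexNormal hz,
        complexNormal_dotProduct_self (h.isNormalFrame z hz), smul_zero, add_zero]
    rw [smul_dotProduct, dotProduct_smul, this, smul_zero, smul_zero]
  · rw [smul_smul, mul_comm, ← smul_smul, ← h.smul_fderiv_localCenter hz hv, smul_smul,
      inv_mul_cancel₀ hv, one_smul]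

end IsFramedWintgen

end FramedWintgen

end Submfd

/-! ### Holomorphic factorization and normal frames -/

namespace Submfd

/-- A smooth map with derivatives of the form `φ ⊗ ξ`, where `φ` is a real linear map onto `ℂ` and
`ξ` is isotropic, is locally an isotropic holomorphic curve composed with a submersion. -/
theorem exists_holomorphic_factorization {E : Type*} [NormedAddCommGroup E] [NormedSpace ℝ E]
    [FiniteDimensional ℝ E] {n : ℕ} {X : E → Fin n → ℂ} {O : Set E} (hO : IsOpen O)
    (hX : ∀ z ∈ O, ContDiffAt ℝ ∞ X z)
    (hd : ∀ z ∈ O, ∃ (φ : E → ℂ) (ξ : Fin n → ℂ), Function.Surjective φ ∧ ξ ≠ 0 ∧ ξ ⬝ᵥ ξ = 0 ∧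
      ∀ u, fderiv ℝ X z u = φ u • ξ) {y : E} (hy : y ∈ O) :
    ∃ (U : Set E) (ζ : E → ℂ) (V : Set ℂ) (F : ℂ → Fin n → ℂ), IsOpen U ∧ y ∈ U ∧ U ⊆ O ∧
      (∀ z ∈ U, ContDiffAt ℝ ∞ ζ z ∧ Function.Surjective (fderiv ℝ ζ z)) ∧
      ζ '' U = V ∧ IsOpen V ∧ V ⊆ Metric.ball 0 1 ∧ DifferentiableOn ℂ F V ∧
      (∀ w ∈ V, deriv F w ≠ 0 ∧ ∑ j, (deriv F w j) ^ 2 = 0) ∧ ∀ z ∈ U, F (ζ z) = X z := by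
  obtain ⟨φ0, ξ0, hφ0, hξ0, -, hXd0⟩ := hd y hy
  obtain ⟨j, hj⟩ := Function.ne_iff.mp hξ0
  -- A component of X itself serves as the complex coordinate, so the ratio ξ / ξⱼ becomes the
  -- derivative of the curve. Subtracting the value at y puts y over 0.
  set ζ : E → ℂ := fun z => X z j - X y j with hζ
  have hζc : ∀ z ∈ O, ContDiffAt ℝ ∞ ζ z := fun z hz =>
    (contDiffAt_pi.mp (hX z hz) j).sub contDiffAt_const
  have hζd : ∀ z ∈ O, ∀ u, fderiv ℝ ζ z u = fderiv ℝ X z u j := by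
    intro z hz u
    have h1 := (hasFDerivAt_pi'.mp ((hX z hz).differentiableAt (by simp)).hasFDerivAt j).sub_const
      (X y j)
    have h2 : HasFDerivAt ζ _ z := h1
    rw [h2.fderiv]
    rfl
  have hsurj0 : Function.Surjective (fderiv ℝ ζ y) := by
    intro w
    obtain ⟨u, hu⟩ := hφ0 (w / ξ0 j)
    refine ⟨u, ?_⟩
    rw [hζd y hy, hXd0, hu, Pi.smul_apply, smul_eq_mul, div_mul_cancel₀ _ hj]
  obtain ⟨u0, hu0⟩ := hsurj0 1
  -- The vectors ξ are chosen pointwise, without continuity. That one directional derivative of ζ is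
  -- nonzero is an open condition, and it forces ξⱼ ≠ 0.
  have hev : ∀ᶠ z in nhds y, fderiv ℝ ζ z u0 ≠ 0 :=
    (((hζc y hy).fderiv_right (m := ∞) (by simp)).clm_apply
      contDiffAt_const).continuousAt.eventually_ne (by rw [hu0]; exact one_ne_zero)
  have key : ∀ z ∈ O, fderiv ℝ ζ z u0 ≠ 0 → Function.Surjective (fderiv ℝ ζ z) ∧
      ∃ τ : Fin n → ℂ, τ ≠ 0 ∧ τ ⬝ᵥ τ = 0 ∧ ∀ u, fderiv ℝ X z u = fderiv ℝ ζ z u • τ := by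
    intro z hz hz0
    obtain ⟨φ, ξ, hφ, hξ, hξξ, hXd⟩ := hd z hz
    have hζφ : ∀ u, fderiv ℝ ζ z u = φ u * ξ j := fun u => by rw [hζd z hz, hXd]; rfl
    have hξj : ξ j ≠ 0 := right_ne_zero_of_mul (hζφ u0 ▸ hz0)
    refine ⟨fun w => ?_, (ξ j)⁻¹ • ξ, smul_ne_zero (inv_ne_zero hξj) hξ, ?_, fun u => ?_⟩
    · obtain ⟨u, hu⟩ := hφ (w / ξ j)
      exact ⟨u, by rw [hζφ, hu, div_mul_cancel₀ _ hξj]⟩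
    · rw [smul_dotProduct, dotProduct_smul, hξξ, smul_zero, smul_zero]
    · rw [hXd, hζφ, smul_smul, mul_assoc, mul_inv_cancel₀ hξj, mul_one]
  -- A projection onto the kernel of dζ at y completes ζ to a local diffeomorphism to ℂ × T.
  set T : Submodule ℝ E := LinearMap.ker (fderiv ℝ ζ y).toLinearMap with hT
  obtain ⟨P, hP⟩ : T.ClosedComplemented :=
    ContinuousLinearMap.ker_closedComplemented_of_finiteDimensional_range (fderiv ℝ ζ y)
  set L : E →L[ℝ] ℂ × T := (fderiv ℝ ζ y).prod P with hL
  have hLb : Function.Bijective L := by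
    constructor
    · refine (injective_iff_map_eq_zero L).mpr fun u hu => ?_
      have h1 : fderiv ℝ ζ y u = 0 := congrArg Prod.fst hu
      have h2 : P u = 0 := congrArg Prod.snd hu
      have h3 := hP ⟨u, h1⟩
      simp only at h3
      rw [h2] at h3
      exact (congrArg Subtype.val h3).symm
    · rintro ⟨w, t⟩
      obtain ⟨u, hu⟩ := hsurj0 w
      have hk (t : T) : fderiv ℝ ζ y t = 0 := t.2
      refine ⟨u - P u + t, Prod.ext ?_ ?_⟩
      · change fderiv ℝ ζ y _ = w
        rw [map_add, map_sub, hk, hk, hu, sub_zero, add_zero]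
      · change P _ = t
        rw [map_add, map_sub, hP, hP, sub_self, zero_add]
  set Le : E ≃L[ℝ] ℂ × T := (LinearEquiv.ofBijective L.toLinearMap hLb).toContinuousLinearEquiv
    with hLe
  set Φ : E → ℂ × T := fun z => (ζ z, P z) with hΦ
  have hΦc : ContDiffAt ℝ ∞ Φ y := (hζc y hy).prodMk P.contDiff.contDiffAt
  have hΦd : HasFDerivAt Φ (Le : E →L[ℝ] ℂ × T) y :=
    ((hζc y hy).differentiableAt (by simp)).hasFDerivAt.prodMk P.hasFDerivAt
  set e := hΦc.toOpenPartialHomeomorph Φ hΦd (by simp) with he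
  have hyse : y ∈ e.source := hΦc.mem_toOpenPartialHomeomorph_source hΦd (by simp)
  have hyte : Φ y ∈ e.target := hΦc.image_mem_toOpenPartialHomeomorph_target hΦd (by simp)
  have hsymm : ContDiffAt ℝ ∞ e.symm (Φ y) := hΦc.to_localInverse hΦd (by simp)
  have hsy : e.symm (Φ y) = y := e.left_inv hyse
  have hev2 : ∀ᶠ p in nhds (Φ y), p ∈ e.target ∧ DifferentiableAt ℝ e.symm p ∧ e.symm p ∈ O ∧
      fderiv ℝ ζ (e.symm p) u0 ≠ 0 := by
    have h1 : ∀ᶠ p in nhds (Φ y), DifferentiableAt ℝ e.symm p :=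
      ((hsymm.of_le two_le_infty).eventually (by decide)).mono fun p hp =>
        hp.differentiableAt (by simp)
    have h2 : Filter.Tendsto e.symm (nhds (Φ y)) (nhds y) := by
      have := hsymm.continuousAt.tendsto
      rwa [hsy] at this
    exact (e.open_target.eventually_mem hyte).and (h1.and ((h2.eventually (hO.eventually_mem hy)).and
      (h2.eventually hev)))
  have hΦy : Φ y = (0, P y) := by simp [hΦ, hζ]
  obtain ⟨r0, hr0, hball⟩ := Metric.mem_nhds_iff.mp hev2
  -- The bound 1 keeps the domain of the curve in the unit disc, so that domains can later be made
  -- disjoint by translations.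
  set r := min r0 1 with hr
  have hrpos : 0 < r := lt_min hr0 one_pos
  set t0 : T := P y with ht0
  set B : Set (ℂ × T) := Metric.ball 0 r ×ˢ Metric.ball t0 r with hB
  have hBsub : ∀ p ∈ B, p ∈ e.target ∧ DifferentiableAt ℝ e.symm p ∧ e.symm p ∈ O ∧
      fderiv ℝ ζ (e.symm p) u0 ≠ 0 := by
    intro p hp
    apply hball
    rw [hΦy, Metric.mem_ball, Prod.dist_eq]
    exact max_lt (lt_of_lt_of_le hp.1 (min_le_left _ _)) (lt_of_lt_of_le hp.2 (min_le_left _ _))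
  have hBo : IsOpen B := Metric.isOpen_ball.prod Metric.isOpen_ball
  have hζs : ∀ p ∈ B, ζ (e.symm p) = p.1 := fun p hp =>
    congrArg Prod.fst (e.right_inv (hBsub p hp).1)
  have hXs : ∀ p ∈ B, ∃ τ : Fin n → ℂ, τ ≠ 0 ∧ τ ⬝ᵥ τ = 0 ∧ HasFDerivAt (fun p => X (e.symm p))
      ((ContinuousLinearMap.fst ℝ ℂ T).smulRight τ) p := by
    intro p hp
    obtain ⟨h1, h2, h3, h4⟩ := hBsub p hp
    obtain ⟨-, τ, hτ, hττ, hXτ⟩ := key _ h3 h4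
    refine ⟨τ, hτ, hττ, ?_⟩
    have h5 := ((hX _ h3).differentiableAt (by simp)).hasFDerivAt.comp p h2.hasFDerivAt
    have h6 := ((hζc _ h3).differentiableAt (by simp)).hasFDerivAt.comp p h2.hasFDerivAt
    have h7 : HasFDerivAt (ζ ∘ e.symm) (ContinuousLinearMap.fst ℝ ℂ T) p :=
      hasFDerivAt_fst.congr_of_eventuallyEq ((hBo.eventually_mem hp).mono
        fun q hq => hζs q hq)
    have h8 := h6.unique h7
    refine h5.congr_fderiv (ContinuousLinearMap.ext fun v => ?_)
    change fderiv ℝ X (e.symm p) (fderiv ℝ e.symm p v) = v.1 • τ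
    rw [hXτ]
    congr 1
    exact congrArg (fun L => L v) h8
  -- In the coordinates (w, t) the derivative of X is dw ⊗ τ, so X is constant along the balls of
  -- the T-directions.
  have hfib : ∀ w ∈ Metric.ball (0 : ℂ) r, ∀ t ∈ Metric.ball t0 r,
      X (e.symm (w, t)) = X (e.symm (w, t0)) := by
    intro w hw t ht
    have hder : ∀ s ∈ Metric.ball t0 r,
        HasFDerivAt (fun s => X (e.symm (w, s))) (0 : T →L[ℝ] Fin n → ℂ) s := by
      intro s hs
      obtain ⟨τ, -, -, hτ⟩ := hXs (w, s) ⟨hw, hs⟩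
      refine (hτ.comp s (hasFDerivAt_prodMk_right w s)).congr_fderiv
        (ContinuousLinearMap.ext fun v => ?_)
      change (0 : ℂ) • τ = 0
      exact zero_smul _ _
    exact Metric.isOpen_ball.is_const_of_fderiv_eq_zero (𝕜 := ℝ)
      (convex_ball t0 r).isPreconnected
      (fun s hs => (hder s hs).differentiableAt.differentiableWithinAt)
      (fun s hs => (hder s hs).fderiv) ht (Metric.mem_ball_self hrpos)
  -- On the slice t = t0 the real derivative is v ↦ v • τ, which is complex linear; hence the curve
  -- is holomorphic with isotropic derivative τ.
  have hFder : ∀ w ∈ Metric.ball (0 : ℂ) r, ∃ τ : Fin n → ℂ, τ ≠ 0 ∧ τ ⬝ᵥ τ = 0 ∧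
      HasDerivAt (fun w => X (e.symm (w, t0))) τ w := by
    intro w hw
    obtain ⟨τ, hτ0, hττ, hτ⟩ := hXs (w, t0) ⟨hw, Metric.mem_ball_self hrpos⟩
    refine ⟨τ, hτ0, hττ, ?_⟩
    have h1 := hτ.comp w (hasFDerivAt_prodMk_left (𝕜 := ℝ) w t0)
    rw [hasDerivAt_iff_hasFDerivAt]
    refine hasFDerivAt_of_restrictScalars ℝ h1 ?_
    ext1 v
    simp
  refine ⟨e.source ∩ e ⁻¹' B, ζ, Metric.ball 0 r, fun w => X (e.symm (w, t0)),
    e.isOpen_inter_preimage hBo, ⟨hyse, ?_⟩, ?_, ?_, ?_, Metric.isOpen_ball,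
    Metric.ball_subset_ball (min_le_right _ _), ?_, ?_, ?_⟩
  · change Φ y ∈ B
    rw [hΦy]
    exact ⟨Metric.mem_ball_self hrpos, Metric.mem_ball_self hrpos⟩
  · rintro z ⟨hz1, hz2⟩
    rw [← e.left_inv hz1]
    exact (hBsub _ hz2).2.2.1
  · rintro z ⟨hz1, hz2⟩
    obtain ⟨-, -, h1, h2⟩ := hBsub _ hz2
    rw [e.left_inv hz1] at h1 h2
    exact ⟨hζc z h1, (key z h1 h2).1⟩
  · ext w
    constructor
    · rintro ⟨z, ⟨-, hz2⟩, rfl⟩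
      exact hz2.1
    · intro hw
      have hm : (w, t0) ∈ B := ⟨hw, Metric.mem_ball_self hrpos⟩
      refine ⟨e.symm (w, t0), ⟨e.map_target (hBsub _ hm).1, ?_⟩, hζs _ hm⟩
      rw [Set.mem_preimage, e.right_inv (hBsub _ hm).1]
      exact hm
  · intro w hw
    obtain ⟨τ, -, -, h⟩ := hFder w hw
    exact h.differentiableAt.differentiableWithinAt
  · intro w hw
    obtain ⟨τ, h0, h1, h⟩ := hFder w hw
    rw [h.deriv]
    refine ⟨h0, ?_⟩
    rw [← h1]
    exact Finset.sum_congr rfl fun j _ => sq _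
  · rintro z ⟨hz1, hz2⟩
    have : e.symm (ζ z, P z) = z := e.left_inv hz1
    have h1 := hfib (ζ z) hz2.1 (P z) hz2.2
    rw [this] at h1
    exact h1.symm

/-- Local existence of smooth orthonormal normal frames in codimension two. -/
theorem exists_smooth_normalFrame {k : ℕ} {g : Euc k → Euc (k + 2)} {O : Set (Euc k)}
    (hO : IsOpen O) (hg : ∀ z ∈ O, ContDiffAt ℝ ∞ g z)
    (hi : ∀ z ∈ O, Function.Injective (fderiv ℝ g z)) {y : Euc k} (hy : y ∈ O) :
    ∃ (U : Set (Euc k)) (ν : Euc k → Fin 2 → Euc (k + 2)), IsOpen U ∧ y ∈ U ∧ U ⊆ O ∧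
      (∀ z ∈ U, ∀ a, ContDiffAt ℝ ∞ (fun z => ν z a) z) ∧ ∀ z ∈ U, IsNormalFrame g z (ν z) := by
  have hfr : Module.finrank ℝ (tangentSpan g y)ᗮ = 2 := by
    have h1 := Submodule.finrank_add_finrank_orthogonal (tangentSpan g y)
    have h2 : Module.finrank ℝ (tangentSpan g y) = k := by
      rw [tangentSpan, LinearMap.finrank_range_of_inj (hi y hy)]
      simp
    rw [h2] at h1
    simp only [finrank_euclideanSpace, Fintype.card_fin] at h1
    omega
  set b := (stdOrthonormalBasis ℝ (tangentSpan g y)ᗮ).reindex (finCongr hfr) with hb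
  set c : Fin 2 → Euc (k + 2) := fun a => b a with hc
  have hco : ∀ a a', inner ℝ (c a) (c a') = if a = a' then (1 : ℝ) else 0 := fun a a' =>
    orthonormal_iff_ite.mp b.orthonormal a a'
  have hcn : ∀ a, normalProj g y (c a) = c a := fun a => normalProj_eq_self (b a).2
  -- Gram-Schmidt applied to the normal projections of a fixed orthonormal basis of the normal space
  -- at y.
  set p : Euc k → Euc (k + 2) := fun z => normalProj g z (c 0) with hp
  set b0 : Euc k → Euc (k + 2) := fun z => ‖p z‖⁻¹ • p z with hb0
  set t : Euc k → Euc (k + 2) := fun z =>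
    normalProj g z (c 1) - (inner ℝ (b0 z) (normalProj g z (c 1)) : ℝ) • b0 z with ht
  have hn (a : Fin 2) : ∀ z ∈ O, ContDiffAt ℝ ∞ (fun z => normalProj g z (c a)) z := fun z hz =>
    (contDiffAt_normalProj (hg z hz) (hi z hz)).clm_apply contDiffAt_const
  have hb0c : ∀ z ∈ O, p z ≠ 0 → ContDiffAt ℝ ∞ b0 z := fun z hz h0 =>
    (((hn 0 z hz).norm ℝ h0).inv (norm_ne_zero_iff.mpr h0)).smul (hn 0 z hz)
  have htc : ∀ z ∈ O, p z ≠ 0 → ContDiffAt ℝ ∞ t z := fun z hz h0 =>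
    (hn 1 z hz).sub (((hb0c z hz h0).inner ℝ (hn 1 z hz)).smul (hb0c z hz h0))
  have hc0 : c 0 ≠ 0 := fun h => by simpa [h] using hco 0 0
  have hc1 : c 1 ≠ 0 := fun h => by simpa [h] using hco 1 1
  have hpy : p y = c 0 := hcn 0
  have hty : t y = c 1 := by
    have : inner ℝ (c 0) (c 1) = (0 : ℝ) := by simpa using hco 0 1
    simp only [ht, hb0, hpy, hcn, real_inner_smul_left, this, mul_zero, zero_smul, sub_zero]
  have hpy0 : p y ≠ 0 := hpy ▸ hc0
  have hev : ∀ᶠ z in nhds y, z ∈ O ∧ p z ≠ 0 ∧ t z ≠ 0 :=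
    (hO.eventually_mem hy).and (((hn 0 y hy).continuousAt.eventually_ne hpy0).and
      ((htc y hy hpy0).continuousAt.eventually_ne (hty ▸ hc1)))
  obtain ⟨U, hUs, hUo, hyU⟩ := mem_nhds_iff.mp hev
  refine ⟨U, fun z => ![b0 z, ‖t z‖⁻¹ • t z], hUo, hyU, fun z hz => (hUs hz).1, ?_, ?_⟩
  · intro z hz a
    obtain ⟨h1, h2, h3⟩ := hUs hz
    fin_cases a
    · exact hb0c z h1 h2
    · exact (((htc z h1 h2).norm ℝ h3).inv (norm_ne_zero_iff.mpr h3)).smul (htc z h1 h2)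
  · intro z hz
    obtain ⟨h1, h2, h3⟩ := hUs hz
    have hm0 : b0 z ∈ (tangentSpan g z)ᗮ := Submodule.smul_mem _ _ (normalProj_mem _)
    have hm1 : t z ∈ (tangentSpan g z)ᗮ :=
      Submodule.sub_mem _ (normalProj_mem _) (Submodule.smul_mem _ _ hm0)
    have n0 : ‖b0 z‖ = 1 := norm_smul_inv_norm h2
    have n1 : ‖‖t z‖⁻¹ • t z‖ = 1 := norm_smul_inv_norm h3
    have h01 : inner ℝ (b0 z) (t z) = 0 := by
      simp only [ht]
      rw [inner_sub_right, real_inner_smul_right, real_inner_self_eq_norm_sq, n0]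
      ring
    constructor
    · rw [orthonormal_vecCons_iff]
      refine ⟨n0, ?_, ?_⟩
      · intro i
        fin_cases i
        simp [real_inner_smul_right, h01]
      · rw [orthonormal_vecCons_iff]
        exact ⟨n1, fun i => i.elim0, by simp [Orthonormal, Pairwise]⟩
    · intro a
      fin_cases a
      · exact hm0
      · exact Submodule.smul_mem _ _ hm1

end Submfd

namespace Submfd

/-! ### Dependence on the germ only -/

section Germ

variable {k n : ℕ} {f g : Euc k → Euc n} {y : Euc k}

theorem tangentSpan_congr (h : f =ᶠ[nhds y] g) : tangentSpan f y = tangentSpan g y := by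
  rw [tangentSpan, tangentSpan, h.fderiv_eq]

theorem secondFF_congr (h : f =ᶠ[nhds y] g) : secondFF f y = secondFF g y := by
  funext u v
  simp only [secondFF, normalProj, tangentSpan_congr h, h.fderiv.fderiv_eq]

theorem gram_congr (h : f =ᶠ[nhds y] g) : gram f y = gram g y := by
  rw [gram, gram, h.fderiv_eq]

theorem meanCurv_congr (h : f =ᶠ[nhds y] g) : meanCurv f y = meanCurv g y := by
  rw [meanCurv, meanCurv, secondFF_congr h, gram_congr h]

theorem tracelessFF_congr (h : f =ᶠ[nhds y] g) : tracelessFF f y = tracelessFF g y := by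
  funext u v
  rw [tracelessFF, tracelessFF, secondFF_congr h, meanCurv_congr h, h.fderiv_eq]

theorem IsWintgenAt.congr {f g : Euc k → Euc (k + 2)} (hf : IsWintgenAt f y)
    (h : f =ᶠ[nhds y] g) : IsWintgenAt g y := by
  obtain ⟨e, he, h1⟩ := hf
  refine ⟨e, by rwa [IsTangentFrame, ← h.fderiv_eq], fun ν hν => ?_⟩
  have h2 := h1 ν (by rwa [IsNormalFrame, tangentSpan_congr h])
  simpa only [complexFF, tracelessFF_congr h] using h2

end Germ

theorem mfderiv_eq_fderiv_localRep {k n : ℕ} {M : Type*} [TopologicalSpace M]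
    [ChartedSpace (Euc k) M] {x : M → Euc n} {p : M} (hx : MDifferentiableAt (𝓡 k) (𝓡 n) x p) :
    mfderiv (𝓡 k) (𝓡 n) x p = fderiv ℝ (localRep k x p) (coord k p) := by
  rw [hx.mfderiv]
  simp only [writtenInExtChartAt, extChartAt_model_space_eq_id, modelWithCornersSelf_coe,
    Set.range_id, fderivWithin_univ]
  rfl

/-! ### Real parts of isotropic holomorphic curves -/

section MinimalSurface

variable {n : ℕ}

/-- The plane as `ℂ`. -/
noncomputable def planeEquiv : Euc 2 ≃L[ℝ] ℂ :=
  Complex.orthonormalBasisOneI.repr.symm.toContinuousLinearEquiv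

theorem planeEquiv_single_zero : planeEquiv (EuclideanSpace.single 0 1) = 1 := by
  change Complex.orthonormalBasisOneI.repr.symm _ = _
  rw [OrthonormalBasis.repr_symm_single]
  simp

theorem planeEquiv_single_one : planeEquiv (EuclideanSpace.single 1 1) = Complex.I := by
  change Complex.orthonormalBasisOneI.repr.symm _ = _
  rw [OrthonormalBasis.repr_symm_single]
  simp

/-- The real part of a complex vector. -/
noncomputable def rePart : (Fin n → ℂ) →L[ℝ] Euc n :=
  (EuclideanSpace.equiv (Fin n) ℝ).symm.toContinuousLinearMap.comp
    (ContinuousLinearMap.pi fun j => Complex.reCLM.comp (ContinuousLinearMap.proj j))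

theorem rePart_apply (v : Fin n → ℂ) : rePart v = WithLp.toLp 2 fun j => (v j).re := rfl

/-- Conformality. From 2 Re z Re w = Re(z w) + Re(z w̄), the first kind of term sums to Re(ab Σ vⱼ²)
= 0. -/
theorem inner_rePart_smul {v : Fin n → ℂ} (hv : ∑ j, v j ^ 2 = 0) (a b : ℂ) :
    inner ℝ (rePart (a • v)) (rePart (b • v)) =
      (a.re * b.re + a.im * b.im) * ((∑ j, Complex.normSq (v j)) / 2) := by
  have h1 : (a * b * ∑ j, v j ^ 2).re = 0 := by rw [hv, mul_zero, Complex.zero_re]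
  rw [Finset.mul_sum, Complex.re_sum] at h1
  simp only [rePart_apply, PiLp.inner_apply, Pi.smul_apply, smul_eq_mul, RCLike.inner_apply,
    conj_trivial]
  rw [← mul_div_assoc, eq_div_iff two_ne_zero, Finset.mul_sum, Finset.sum_mul, ← sub_eq_zero, ← h1,
    ← Finset.sum_sub_distrib]
  refine Finset.sum_congr rfl fun j _ => ?_
  rw [Complex.normSq_apply]
  simp only [sq, Complex.mul_re, Complex.mul_im]
  ring

variable {G : ℂ → Fin n → ℂ} {W : Set ℂ} {y : Euc 2}

/-- The real part of a holomorphic curve. -/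
noncomputable def realSurface (G : ℂ → Fin n → ℂ) (y : Euc 2) : Euc n := rePart (G (planeEquiv y))

theorem contDiffAt_realSurface (hW : IsOpen W) (hG : DifferentiableOn ℂ G W)
    (hy : planeEquiv y ∈ W) : ContDiffAt ℝ ∞ (realSurface G) y :=
  rePart.contDiff.contDiffAt.comp y ((((hG.contDiffOn hW).contDiffAt
    (hW.mem_nhds hy)).restrict_scalars ℝ).comp y planeEquiv.contDiff.contDiffAt)

theorem fderiv_rePart_comp {G : ℂ → Fin n → ℂ} (hG : DifferentiableAt ℂ G (planeEquiv y))
    (u : Euc 2) : fderiv ℝ (fun z => rePart (G (planeEquiv z))) y u =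
      rePart (planeEquiv u • deriv G (planeEquiv y)) := by
  have h1 := hG.hasDerivAt.hasFDerivAt.restrictScalars ℝ
  have h2 := rePart.hasFDerivAt.comp y
    (h1.comp y (planeEquiv : Euc 2 →L[ℝ] ℂ).hasFDerivAt)
  have h3 : HasFDerivAt (fun z => rePart (G (planeEquiv z))) _ y := h2
  rw [h3.fderiv]
  rfl

theorem fderiv_realSurface (hW : IsOpen W) (hG : DifferentiableOn ℂ G W)
    (hy : planeEquiv y ∈ W) (u : Euc 2) : fderiv ℝ (realSurface G) y u =
      rePart (planeEquiv u • deriv G (planeEquiv y)) :=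
  fderiv_rePart_comp (hG.differentiableAt (hW.mem_nhds hy)) u

theorem fderiv_fderiv_realSurface (hW : IsOpen W) (hG : DifferentiableOn ℂ G W)
    (hy : planeEquiv y ∈ W) (u v : Euc 2) : fderiv ℝ (fderiv ℝ (realSurface G)) y u v =
      rePart ((planeEquiv u * planeEquiv v) • deriv (deriv G) (planeEquiv y)) := by
  have hd : DifferentiableAt ℝ (fderiv ℝ (realSurface G)) y :=
    (contDiffAt_fderiv (contDiffAt_realSurface hW hG hy)).differentiableAt (by simp)
  have hG' : DifferentiableAt ℂ (deriv G) (planeEquiv y) :=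
    (hG.deriv hW).differentiableAt (hW.mem_nhds hy)
  have h1 : (fun z => fderiv ℝ (realSurface G) z v) =ᶠ[nhds y]
      fun z => rePart (planeEquiv v • deriv G (planeEquiv z)) := by
    filter_upwards [(hW.preimage planeEquiv.continuous).mem_nhds hy] with z hz
    exact fderiv_realSurface hW hG hz v
  rw [← fderiv_clm_apply_const hd, h1.fderiv_eq,
    fderiv_rePart_comp (G := fun w => planeEquiv v • deriv G w) (hG'.fun_const_smul _),
    deriv_fun_const_smul_field, smul_smul]

theorem sum_normSq_pos {v : Fin n → ℂ} (hv : v ≠ 0) : 0 < (∑ j, Complex.normSq (v j)) / 2 := by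
  obtain ⟨j, hj⟩ := Function.ne_iff.mp hv
  exact half_pos (Finset.sum_pos' (fun i _ => Complex.normSq_nonneg _)
    ⟨j, Finset.mem_univ j, Complex.normSq_pos.mpr hj⟩)

theorem injective_fderiv_realSurface (hW : IsOpen W) (hG : DifferentiableOn ℂ G W)
    (hy : planeEquiv y ∈ W) (h0 : deriv G (planeEquiv y) ≠ 0)
    (h1 : ∑ j, deriv G (planeEquiv y) j ^ 2 = 0) :
    Function.Injective (fderiv ℝ (realSurface G) y) := by
  refine (injective_iff_map_eq_zero (fderiv ℝ (realSurface G) y)).mpr fun u hu => ?_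
  rw [fderiv_realSurface hW hG hy] at hu
  have h2 := inner_rePart_smul h1 (planeEquiv u) (planeEquiv u)
  rw [hu, inner_zero_left] at h2
  have h3 := (mul_eq_zero.mp h2.symm).resolve_right (sum_normSq_pos h0).ne'
  rw [← Complex.normSq_apply, Complex.normSq_eq_zero] at h3
  exact planeEquiv.map_eq_zero_iff.mp h3

/-- The real part of a holomorphic isotropic curve is a minimal surface. -/
theorem meanCurv_realSurface (hW : IsOpen W) (hG : DifferentiableOn ℂ G W)
    (hy : planeEquiv y ∈ W) (h0 : deriv G (planeEquiv y) ≠ 0)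
    (h1 : ∑ j, deriv G (planeEquiv y) j ^ 2 = 0) : meanCurv (realSurface G) y = 0 := by
  set ρ := (∑ j, Complex.normSq (deriv G (planeEquiv y) j)) / 2 with hρ
  have hρ0 : 0 < ρ := sum_normSq_pos h0
  set s : ℝ := (Real.sqrt ρ)⁻¹ with hs
  have hsρ : s * s * ρ = 1 := by
    rw [hs, ← mul_inv, Real.mul_self_sqrt hρ0.le, inv_mul_cancel₀ hρ0.ne']
  set e : Fin 2 → Euc 2 := fun i => s • EuclideanSpace.single i 1 with he
  have e0 : planeEquiv (e 0) = s := by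
    simp only [he]
    rw [map_smul, planeEquiv_single_zero]
    simp
  have e1 : planeEquiv (e 1) = s * Complex.I := by
    simp only [he]
    rw [map_smul, planeEquiv_single_one]
    simp
  have hf : IsTangentFrame (realSurface G) y e := by
    rw [IsTangentFrame, orthonormal_iff_ite]
    intro i j
    rw [fderiv_realSurface hW hG hy, fderiv_realSurface hW hG hy, inner_rePart_smul h1, ← hρ]
    fin_cases i <;> fin_cases j <;> simp [e0, e1] <;> linarith
  rw [meanCurv_eq_of_isTangentFrame hf, Fin.sum_univ_two, secondFF, secondFF, ← map_add,
    fderiv_fderiv_realSurface hW hG hy, fderiv_fderiv_realSurface hW hG hy, ← map_add, ← add_smul,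
    e0, e1]
  -- Harmonicity: the trace of the second derivative is (s² + (is)²) G'' = 0.
  have : (s * s + s * Complex.I * (s * Complex.I) : ℂ) = 0 := by
    linear_combination (s : ℂ) ^ 2 * Complex.I_sq
  rw [this, zero_smul, map_zero, map_zero, smul_zero]

/-- The open subset of the plane that corresponds to an open subset of `ℂ`. -/
noncomputable def planeOpens (hW : IsOpen W) : TopologicalSpace.Opens (Euc 2) :=
  ⟨planeEquiv ⁻¹' W, hW.preimage planeEquiv.continuous⟩

theorem extChartAt_opens (U : TopologicalSpace.Opens (Euc 2)) (s q : U) :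
    extChartAt (𝓡 2) s q = (q : Euc 2) := by
  simp [extChartAt, TopologicalSpace.Opens.chartAt_eq]
  rfl

theorem localRep_opens (U : TopologicalSpace.Opens (Euc 2)) (f : Euc 2 → Euc n) (s : U) :
    localRep 2 (fun q : U => f q) s =ᶠ[nhds (s : Euc 2)] f := by
  have h1 := extChartAt_target_mem_nhds (I := 𝓡 2) s
  rw [extChartAt_opens] at h1
  filter_upwards [h1] with z hz
  have h2 := (extChartAt (𝓡 2) s).right_inv hz
  rw [extChartAt_opens] at h2
  change f ((extChartAt (𝓡 2) s).symm z) = f z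
  rw [h2]

theorem isMinimalImmersion_realSurface (hW : IsOpen W) (hG : DifferentiableOn ℂ G W)
    (h : ∀ w ∈ W, deriv G w ≠ 0 ∧ ∑ j, deriv G w j ^ 2 = 0) :
    IsMinimalImmersion 2 fun q : planeOpens hW => realSurface G q := by
  have hc : ContMDiff (𝓡 2) (𝓡 n) ∞ fun q : planeOpens hW => realSurface G q := fun q =>
    (contDiffAt_realSurface hW hG q.2).contMDiffAt.comp q contMDiff_subtype_val.contMDiffAt
  refine ⟨⟨hc, fun q => ?_⟩, fun q => ?_⟩
  · rw [mfderiv_eq_fderiv_localRep (hc.mdifferentiableAt (by simp)), coord, extChartAt_opens, (localRep_opens _ _ q).fderiv_eq]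
    exact injective_fderiv_realSurface hW hG q.2 (h _ q.2).1 (h _ q.2).2
  · rw [meanCurvature, coord, extChartAt_opens, meanCurv_congr (localRep_opens _ _ q)]
    exact meanCurv_realSurface hW hG q.2 (h _ q.2).1 (h _ q.2).2

/-- Countably many holomorphic curves defined on subsets of the unit disc, reparametrized by
translations to be defined on disjoint sets. -/
theorem exists_disjoint_translates {T : Type*} [Countable T] (V : T → Set ℂ)
    (F : T → ℂ → Fin n → ℂ) (hV : ∀ i, IsOpen (V i)) (hb : ∀ i, V i ⊆ Metric.ball 0 1)
    (hF : ∀ i, DifferentiableOn ℂ (F i) (V i)) :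
    ∃ (a : T → ℂ) (G : ℂ → Fin n → ℂ) (W : Set ℂ), IsOpen W ∧ DifferentiableOn ℂ G W ∧
      (∀ w ∈ W, ∃ i, w - a i ∈ V i ∧ G w = F i (w - a i) ∧ deriv G w = deriv (F i) (w - a i)) ∧
      ∀ i, ∀ w ∈ V i, w + a i ∈ W ∧ G (w + a i) = F i w := by
  obtain ⟨enc, henc⟩ := exists_injective_nat T
  -- Open unit discs whose centers are at least 2 apart are disjoint.
  set a : T → ℂ := fun i => 2 * (enc i : ℂ) with ha
  have hdisj : ∀ w i j, w - a i ∈ V i → w - a j ∈ V j → i = j := by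
    intro w i j hi hj
    apply henc
    have h1 : dist (w - a i) (w - a j) < 2 := by
      have := dist_triangle_right (w - a i) (w - a j) 0
      have h2 := Metric.mem_ball.mp (hb i hi)
      have h3 := Metric.mem_ball.mp (hb j hj)
      linarith
    have h2 : dist (w - a i) (w - a j) = 2 * |((enc j : ℤ) - (enc i : ℤ) : ℝ)| := by
      have : w - a i - (w - a j) = ((2 * ((enc j : ℤ) - (enc i : ℤ)) : ℝ) : ℂ) := by
        simp only [ha]; push_cast; ring
      rw [dist_eq_norm, this, Complex.norm_real, Real.norm_eq_abs, abs_mul, abs_two]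
    rw [h2] at h1
    have h3 : |((enc j : ℤ) - (enc i : ℤ) : ℝ)| < 1 := by linarith
    have h4 : |(enc j : ℤ) - (enc i : ℤ)| < 1 := by exact_mod_cast h3
    have := Int.abs_lt_one_iff.mp h4
    omega
  classical
  -- By disjointness the chosen index is the only one; the value 0 elsewhere plays no role.
  set G : ℂ → Fin n → ℂ := fun w =>
    if h : ∃ i, w - a i ∈ V i then F h.choose (w - a h.choose) else 0 with hG
  have hGi : ∀ i w, w - a i ∈ V i → G w = F i (w - a i) := by
    intro i w hw
    have h : ∃ i, w - a i ∈ V i := ⟨i, hw⟩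
    simp only [hG, dif_pos h]
    rw [hdisj w _ i h.choose_spec hw]
  have hopen : ∀ i, IsOpen {w | w - a i ∈ V i} := fun i =>
    (hV i).preimage (continuous_id.sub continuous_const)
  have hev : ∀ i w, w - a i ∈ V i → G =ᶠ[nhds w] fun w => F i (w - a i) := fun i w hw => by
    filter_upwards [(hopen i).mem_nhds hw] with z hz
    exact hGi i z hz
  refine ⟨a, G, ⋃ i, {w | w - a i ∈ V i}, isOpen_iUnion hopen, ?_, ?_, ?_⟩
  · intro w hw
    obtain ⟨i, hi⟩ := Set.mem_iUnion.mp hw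
    have h1 : DifferentiableAt ℂ (fun w => F i (w - a i)) w :=
      ((hF i).differentiableAt ((hV i).mem_nhds hi)).comp w
        (differentiableAt_id.sub_const (a i))
    exact (h1.congr_of_eventuallyEq (hev i w hi)).differentiableWithinAt
  · intro w hw
    obtain ⟨i, hi⟩ := Set.mem_iUnion.mp hw
    exact ⟨i, hi, hGi i w hi, by rw [(hev i w hi).deriv_eq, deriv_comp_sub_const]⟩
  · intro i w hw
    have h1 : w + a i - a i ∈ V i := by rwa [add_sub_cancel_right]
    exact ⟨Set.mem_iUnion.mpr ⟨i, h1⟩, by rw [hGi i _ h1, add_sub_cancel_right]⟩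

end MinimalSurface

end Submfd

namespace Submfd

/-! ### From charts to the manifold -/

section Manifold

variable {m : ℕ} {M : Type*} [TopologicalSpace M] [ChartedSpace (Euc m) M]
  {n : ℕ}

/-- The coordinate change from the preferred chart at `q` to the preferred chart at `p`. -/
noncomputable def coordChange (p q : M) : Euc m → Euc m :=
  extChartAt (𝓡 m) p ∘ (extChartAt (𝓡 m) q).symm

theorem coordChange_coord (p q : M) : coordChange p q (coord m q) = extChartAt (𝓡 m) p q :=
  congrArg (extChartAt (𝓡 m) p) (extChartAt_to_inv q)

theorem eventually_symm_mem_source {p q r : M} (hp : r ∈ (extChartAt (𝓡 m) p).source)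
    (hq : r ∈ (extChartAt (𝓡 m) q).source) : ∀ᶠ z in nhds (extChartAt (𝓡 m) q r),
      z ∈ (extChartAt (𝓡 m) q).target ∧
        (extChartAt (𝓡 m) q).symm z ∈ (extChartAt (𝓡 m) p).source := by
  have h1 := (isOpen_extChartAt_target (I := 𝓡 m) q).eventually_mem
    ((extChartAt (𝓡 m) q).map_source hq)
  have h2 : ContinuousAt (extChartAt (𝓡 m) q).symm (extChartAt (𝓡 m) q r) :=
    continuousAt_extChartAt_symm' hq
  have h3 := h2.eventually ((isOpen_extChartAt_source (I := 𝓡 m) p).eventually_mem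
    (by rwa [(extChartAt (𝓡 m) q).left_inv hq]))
  exact h1.and h3

theorem localRep_eventuallyEq (x : M → Euc n) {p q : M} (hq : q ∈ (extChartAt (𝓡 m) p).source) :
    localRep m x q =ᶠ[nhds (coord m q)] localRep m x p ∘ coordChange p q := by
  filter_upwards [eventually_symm_mem_source hq (mem_extChartAt_source (I := 𝓡 m) q)] with z hz
  change x _ = x ((extChartAt (𝓡 m) p).symm (extChartAt (𝓡 m) p ((extChartAt (𝓡 m) q).symm z)))
  rw [(extChartAt (𝓡 m) p).left_inv hz.2]

variable [IsManifold (𝓡 m) ∞ M]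

theorem contDiffAt_coordChange {p q r : M} (hp : r ∈ (extChartAt (𝓡 m) p).source)
    (hq : r ∈ (extChartAt (𝓡 m) q).source) :
    ContDiffAt ℝ ∞ (coordChange p q) (extChartAt (𝓡 m) q r) := by
  have h := contDiffWithinAt_ext_coord_change (I := 𝓡 m) (n := ∞) p q
    (y := extChartAt (𝓡 m) q r) (by
      rw [PartialEquiv.trans_source, PartialEquiv.symm_source]
      refine ⟨(extChartAt (𝓡 m) q).map_source hq, ?_⟩
      rwa [Set.mem_preimage, (extChartAt (𝓡 m) q).left_inv hq])
  rwa [modelWithCornersSelf_coe, Set.range_id, contDiffWithinAt_univ] at h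

/-- The reverse coordinate change is a local right inverse, so the chain rule gives a right inverse
of the derivative. -/
theorem surjective_fderiv_coordChange {p q : M} (hq : q ∈ (extChartAt (𝓡 m) p).source) :
    Function.Surjective (fderiv ℝ (coordChange p q) (coord m q)) := by
  have h1 := contDiffAt_coordChange hq (mem_extChartAt_source (I := 𝓡 m) q)
  have h2 := contDiffAt_coordChange (mem_extChartAt_source (I := 𝓡 m) q) hq
  have h3 : coordChange q p (extChartAt (𝓡 m) p q) = coord m q :=
    congrArg (extChartAt (𝓡 m) q) ((extChartAt (𝓡 m) p).left_inv hq)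
  have h4 : coordChange p q ∘ coordChange q p =ᶠ[nhds (extChartAt (𝓡 m) p q)] id := by
    filter_upwards [eventually_symm_mem_source (mem_extChartAt_source (I := 𝓡 m) q) hq] with z hz
    change extChartAt (𝓡 m) p ((extChartAt (𝓡 m) q).symm (extChartAt (𝓡 m) q
      ((extChartAt (𝓡 m) p).symm z))) = z
    rw [(extChartAt (𝓡 m) q).left_inv hz.2, (extChartAt (𝓡 m) p).right_inv hz.1]
  have h1' : DifferentiableAt ℝ (coordChange p q) (coordChange q p (extChartAt (𝓡 m) p q)) := by
    rw [h3]
    exact h1.differentiableAt (by simp)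
  have h5 := fderiv_comp _ h1' (h2.differentiableAt (by simp))
  rw [h4.fderiv_eq, fderiv_id, h3] at h5
  intro v
  exact ⟨fderiv ℝ (coordChange q p) (extChartAt (𝓡 m) p q) v, (congrArg (fun L => L v) h5).symm⟩

theorem contDiffAt_localRep {x : M → Euc n} (hx : ContMDiff (𝓡 m) (𝓡 n) ∞ x) (p : M) {y : Euc m}
    (hy : y ∈ (extChartAt (𝓡 m) p).target) : ContDiffAt ℝ ∞ (localRep m x p) y := by
  have h1 := hx.comp_contMDiffOn (contMDiffOn_extChartAt_symm (I := 𝓡 m) (n := ∞) p)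
  exact (contMDiffOn_iff_contDiffOn.mp h1).contDiffAt
    ((isOpen_extChartAt_target (I := 𝓡 m) p).mem_nhds hy)

/-- The pointwise properties of an umbilic-free Wintgen ideal submanifold of codimension two, in
an arbitrary preferred chart around the point. -/
theorem IsWintgenIdeal.localRep_properties {x : M → Euc (m + 2)} (hm : 2 ≤ m)
    (hx : IsWintgenIdeal m x) (humb : ∀ p, ¬ IsUmbilic m x p) {p q : M}
    (hq : q ∈ (extChartAt (𝓡 m) p).source) :
    Function.Injective (fderiv ℝ (localRep m x p) (extChartAt (𝓡 m) p q)) ∧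
    IsWintgenAt (localRep m x p) (extChartAt (𝓡 m) p q) ∧
    (∃ u w, tracelessFF (localRep m x p) (extChartAt (𝓡 m) p q) u w ≠ 0) ∧
    meanCurvature m x q = meanCurv (localRep m x p) (extChartAt (𝓡 m) p q) ∧
    tangentSpan (localRep m x q) (coord m q) =
      tangentSpan (localRep m x p) (extChartAt (𝓡 m) p q) := by
  have hτ := contDiffAt_coordChange hq (mem_extChartAt_source (I := 𝓡 m) q)
  have hs := surjective_fderiv_coordChange hq
  have he := localRep_eventuallyEq x hq
  have hg : ContDiffAt ℝ ∞ (localRep m x p) (coordChange p q (coord m q)) := by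
    rw [coordChange_coord]
    exact contDiffAt_localRep hx.1.1 p ((extChartAt (𝓡 m) p).map_source hq)
  have hgq : ContDiffAt ℝ ∞ (localRep m x q) (coord m q) :=
    contDiffAt_localRep hx.1.1 q (mem_extChartAt_target q)
  have hiq : Function.Injective (fderiv ℝ (localRep m x q) (coord m q)) := by
    have := hx.1.2 q
    rwa [mfderiv_eq_fderiv_localRep (hx.1.1.mdifferentiableAt (by simp))] at this
  -- The hypotheses are used in the preferred chart of q and then carried to the chart of p by the
  -- coordinate change.
  have hWq := (hx.2 q).isWintgenAt hm hgq hiq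
  have hWc := hWq.congr he
  obtain ⟨e, hf, -⟩ := id hWc
  rw [← coordChange_coord]
  refine ⟨?_, hWc.of_comp hg hτ hs, ?_, ?_, ?_⟩
  · refine (injective_iff_map_eq_zero (fderiv ℝ (localRep m x p) _)).mpr fun v hv => ?_
    obtain ⟨u, rfl⟩ := hs v
    have h1 : fderiv ℝ (localRep m x q) (coord m q) u = 0 := by
      rw [he.fderiv_eq]
      exact (fderiv_comp_reparam hg hτ u).trans hv
    have h2 : u = 0 := hiq (by rw [h1, map_zero])
    rw [h2, map_zero]
  · have h1 := humb q
    simp only [IsUmbilic, not_forall] at h1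
    obtain ⟨u, w, huw⟩ := h1
    refine ⟨fderiv ℝ (coordChange p q) (coord m q) u,
      fderiv ℝ (coordChange p q) (coord m q) w, ?_⟩
    have h2 := tracelessFF_comp hg hτ hs hf u w
    rw [← tracelessFF_congr he] at h2
    intro h0
    exact huw (sub_eq_zero.mp (h2.trans h0))
  · rw [meanCurvature, meanCurv_congr he]
    exact meanCurv_comp hg hτ hs hf
  · rw [tangentSpan_congr he]
    exact tangentSpan_comp hg hτ hs

/-- A surjective endomorphism of ℝᵏ is injective and can be cancelled. With A the derivative of the
inclusion of an open set, this avoids computing A. -/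
theorem surjective_of_surjective_comp {k : ℕ} {E : Type*} (A : Euc k →L[ℝ] Euc k) {B : E → Euc k}
    (h : Function.Surjective (A ∘ B)) : Function.Surjective B := by
  have hA : Function.Injective A :=
    (LinearMap.injective_iff_surjective (f := A.toLinearMap)).mpr h.of_comp
  intro t
  obtain ⟨u, hu⟩ := h (A t)
  exact ⟨u, hA hu⟩

/-- With H = aν₀ + bν₁, the real part of (ν₀ - iν₁) / (a - ib) is (aν₀ + bν₁) / (a² + b²), that is H
/ |H|². -/
theorem re_localCenter {g : Euc m → Euc (m + 2)} {y : Euc m} {ν : Euc m → Fin 2 → Euc (m + 2)}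
    (hW : IsWintgenAt g y) (hν : IsNormalFrame g y (ν y)) (j : Fin (m + 2)) :
    (localCenter g ν y j).re = (g y + (‖meanCurv g y‖ ^ 2)⁻¹ • meanCurv g y) j := by
  obtain ⟨e, he, -⟩ := hW
  set a : ℝ := inner ℝ (meanCurv g y) (ν y 0) with ha
  set b : ℝ := inner ℝ (meanCurv g y) (ν y 1) with hb
  have h1 : ‖meanCurv g y‖ ^ 2 = a ^ 2 + b ^ 2 := by
    rw [← real_inner_self_eq_norm_sq, inner_eq_of_mem_orthogonal he hν meanCurv_mem, ha, hb,
      real_inner_comm (ν y 0), real_inner_comm (ν y 1)]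
    ring
  have h2 : meanCurv g y j = a * ν y 0 j + b * ν y 1 j := by
    have h3 := inner_eq_of_mem_orthogonal he hν meanCurv_mem (EuclideanSpace.single j 1)
    simp only [EuclideanSpace.inner_single_right, one_mul, conj_trivial] at h3
    rw [h3, ha, hb, real_inner_comm (ν y 0), real_inner_comm (ν y 1)]
  have h4 : Complex.normSq (a - Complex.I * b) = a ^ 2 + b ^ 2 := by
    rw [Complex.normSq_apply]
    simp
    ring
  change (((g y j : ℝ) : ℂ) + (complexMeanCurv g y (ν y))⁻¹ * (((ν y 0 j : ℝ) : ℂ) - Complex.I *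
    ((ν y 1 j : ℝ) : ℂ))).re = g y j + (‖meanCurv g y‖ ^ 2)⁻¹ * meanCurv g y j
  rw [complexMeanCurv, ← ha, ← hb, h1, h2, Complex.add_re, Complex.ofReal_re, Complex.mul_re,
    Complex.inv_re, Complex.inv_im, h4]
  simp
  ring

variable {x : M → Euc (m + 2)}

/-- Locally the complex centers trace out an isotropic holomorphic curve. -/
theorem exists_isotropic_curve (hm : 2 ≤ m) (hx : IsWintgenIdeal m x)
    (humb : ∀ p, ¬ IsUmbilic m x p) (p : M) (hp : meanCurvature m x p ≠ 0) :
    ∃ (U : Set M) (ν : M → Fin 2 → Euc (m + 2)) (ζ : M → ℂ) (V : Set ℂ)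
      (F : ℂ → Fin (m + 2) → ℂ), V ⊆ Metric.ball 0 1 ∧
      IsOpen U ∧ p ∈ U ∧
      (∀ a, ContMDiffOn (𝓡 m) (𝓡 (m + 2)) ∞ (fun q => ν q a) U) ∧
      (∀ q ∈ U, IsNormalFrame (localRep m x q) (coord m q) (ν q)) ∧
      ContMDiffOn (𝓡 m) 𝓘(ℝ, ℂ) ∞ ζ U ∧
      (∀ q ∈ U, Function.Surjective (mfderiv (𝓡 m) 𝓘(ℝ, ℂ) ζ q)) ∧
      ζ '' U = V ∧ IsOpen V ∧ DifferentiableOn ℂ F V ∧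
      (∀ w ∈ V, deriv F w ≠ 0 ∧ ∑ j, (deriv F w j) ^ 2 = 0) ∧
      ∀ q ∈ U, F (ζ q) = complexCenter m x q (ν q) ∧
        IsMeanCurvatureCenter m x q (WithLp.toLp 2 fun j => (F (ζ q) j).re) := by
  set φ := extChartAt (𝓡 m) p with hφ
  set g := localRep m x p with hg
  have hpt : ∀ z ∈ φ.target, Function.Injective (fderiv ℝ g z) ∧ IsWintgenAt g z ∧
      (∃ u w, tracelessFF g z u w ≠ 0) ∧ meanCurvature m x (φ.symm z) = meanCurv g z := by
    intro z hz
    have h := hx.localRep_properties hm humb (φ.map_target hz)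
    rw [φ.right_inv hz] at h
    exact ⟨h.1, h.2.1, h.2.2.1, h.2.2.2.1⟩
  have hgc : ∀ z ∈ φ.target, ContDiffAt ℝ ∞ g z := fun z hz => contDiffAt_localRep hx.1.1 p hz
  have hy : φ p ∈ φ.target := mem_extChartAt_target p
  obtain ⟨O₁, ν, hO₁, hyO₁, hO₁t, hνc, hνn⟩ := exists_smooth_normalFrame
    (isOpen_extChartAt_target (I := 𝓡 m) p) hgc (fun z hz => (hpt z hz).1) hy
  have hHy : meanCurv g (φ p) ≠ 0 := hp
  have hHev : ∀ᶠ z in nhds (φ p), z ∈ O₁ ∧ meanCurv g z ≠ 0 :=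
    (hO₁.eventually_mem hyO₁).and
      ((contDiffAt_meanCurv (hgc _ hy) (hpt _ hy).1).continuousAt.eventually_ne hHy)
  obtain ⟨O, hOs, hO, hyO⟩ := mem_nhds_iff.mp hHev
  have hOt : O ⊆ φ.target := fun z hz => hO₁t (hOs hz).1
  have hfw : IsFramedWintgen g ν O :=
    { isOpen := hO
      contDiffAt := fun z hz => hgc z (hOt hz)
      injective := fun z hz => (hpt z (hOt hz)).1
      isWintgenAt := fun z hz => (hpt z (hOt hz)).2.1
      contDiffAt_normal := fun z hz => hνc z (hOs hz).1
      isNormalFrame := fun z hz => hνn z (hOs hz).1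
      meanCurv_ne_zero := fun z hz => (hOs hz).2 }
  obtain ⟨U, ζ, V, F, hU, hyU, hUO, hζ, hζV, hV, hVb, hF, hF', hFX⟩ :=
    exists_holomorphic_factorization hO (fun z hz => hfw.contDiffAt_localCenter hz)
      (fun z hz => hfw.exists_fderiv_localCenter_eq hz (hpt z (hOt hz)).2.2.1) hyO
  have hUt : U ⊆ φ.target := hUO.trans hOt
  have hsrc : ∀ q ∈ (chartAt (Euc m) p).source ∩ φ ⁻¹' U, q ∈ φ.source := fun q hq => by
    rw [hφ, extChartAt_source]; exact hq.1
  have hφc : ∀ q ∈ (chartAt (Euc m) p).source ∩ φ ⁻¹' U, ContMDiffAt (𝓡 m) (𝓡 m) ∞ φ q :=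
    fun q hq => contMDiffAt_extChartAt' hq.1
  refine ⟨(chartAt (Euc m) p).source ∩ φ ⁻¹' U, fun q => ν (φ q), fun q => ζ (φ q), V, F, hVb,
    isOpen_extChartAt_preimage p hU, ⟨mem_chart_source _ p, hyU⟩, fun a q hq => ?_, fun q hq => ?_,
    fun q hq => ?_, fun q hq => ?_, ?_, hV, hF, hF', fun q hq => ?_⟩
  · exact ((hνc _ (hOs (hUO hq.2)).1 a).contMDiffAt.comp q (hφc q hq)).contMDiffWithinAt
  · rw [IsNormalFrame, (hx.localRep_properties hm humb (hsrc q hq)).2.2.2.2]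
    exact hνn _ (hOs (hUO hq.2)).1
  · exact ((hζ _ hq.2).1.contMDiffAt.comp q (hφc q hq)).contMDiffWithinAt
  · have h1 : MDifferentiableAt (𝓡 m) 𝓘(ℝ, ℂ) ζ (φ q) :=
      ((hζ _ hq.2).1.differentiableAt (by simp)).mdifferentiableAt
    have h2 := mfderiv_comp q h1 ((hφc q hq).mdifferentiableAt (by simp))
    -- Invertibility of the chart derivative is a statement about C¹ manifolds.
    have h3 : IsManifold (𝓡 m) 1 M := IsManifold.of_le (n := ∞) (by
      exact le_trans (by norm_num) two_le_infty)
    have h4 := (isInvertible_mfderiv_extChartAt (I := 𝓡 m) (hsrc q hq)).bijective.surjective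
    change Function.Surjective (mfderiv (𝓡 m) 𝓘(ℝ, ℂ) (ζ ∘ φ) q)
    rw [h2, mfderiv_eq_fderiv]
    exact (hζ _ hq.2).2.comp h4
  · rw [← hζV]
    ext w
    constructor
    · rintro ⟨q, hq, rfl⟩
      exact ⟨φ q, hq.2, rfl⟩
    · rintro ⟨z, hz, rfl⟩
      refine ⟨φ.symm z, ⟨?_, ?_⟩, ?_⟩
      · rw [← extChartAt_source (𝓡 m)]
        exact φ.map_target (hUt hz)
      · rw [Set.mem_preimage, φ.right_inv (hUt hz)]
        exact hz
      · simp only [φ.right_inv (hUt hz)]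
  · have hH : meanCurvature m x q = meanCurv g (φ q) :=
      (hx.localRep_properties hm humb (hsrc q hq)).2.2.2.1
    have hgq : g (φ q) = x q := congrArg x (φ.left_inv (hsrc q hq))
    rw [hFX _ hq.2]
    constructor
    · funext j
      rw [complexCenter, hH, ← hgq, div_eq_inv_mul]
      rfl
    · rw [isMeanCurvatureCenter_iff, hH]
      refine ⟨(hOs (hUO hq.2)).2, ?_⟩
      ext j
      rw [← hgq]
      exact re_localCenter (hpt _ (hUt hq.2)).2.1 (hνn _ (hOs (hUO hq.2)).1) j

end Manifold

end Submfd

/-! ### The theorem: gluing the local curves -/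

theorem theorem5p1 {m : ℕ} (hm : 2 ≤ m)
    {M : Type*} [TopologicalSpace M] [T2Space M] [SecondCountableTopology M]
    [ChartedSpace (Euc m) M] [IsManifold (𝓡 m) ∞ M]
    (x : M → Euc (m + 2)) (hx : Submfd.IsWintgenIdeal m x)
    (humb : ∀ p, ¬ Submfd.IsUmbilic m x p) :
    -- the centers form an immersed minimal surface `f : S → ℝ^{m+2}`, to which the map assigning
    -- to a point of `M` its center lifts locally as a submersion
    (∃ (S : Type) (_ : TopologicalSpace S) (_ : ChartedSpace (Euc 2) S) (f : S → Euc (m + 2)),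
      T2Space S ∧ SecondCountableTopology S ∧ IsManifold (𝓡 2) ∞ S ∧
      Submfd.IsMinimalImmersion 2 f ∧
      Set.range f = {c | ∃ p, Submfd.IsMeanCurvatureCenter m x p c} ∧
      ∀ p, Submfd.meanCurvature m x p ≠ 0 → ∃ (U : Set M) (π : M → S), IsOpen U ∧ p ∈ U ∧
        ContMDiffOn (𝓡 m) (𝓡 2) ∞ π U ∧
        (∀ q ∈ U, Function.Surjective (mfderiv (𝓡 m) (𝓡 2) π q)) ∧
        ∀ q ∈ U, Submfd.IsMeanCurvatureCenter m x q (f (π q))) ∧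
    -- locally it is the real part of the holomorphic isotropic curve `F` in `ℂ^{m+2}` that is
    -- traced out by `Submfd.complexCenter`
    (∀ p, Submfd.meanCurvature m x p ≠ 0 →
      ∃ (U : Set M) (ν : M → Fin 2 → Euc (m + 2)) (ζ : M → ℂ) (V : Set ℂ)
        (F : ℂ → Fin (m + 2) → ℂ),
        IsOpen U ∧ p ∈ U ∧
        (∀ a, ContMDiffOn (𝓡 m) (𝓡 (m + 2)) ∞ (fun q => ν q a) U) ∧
        (∀ q ∈ U, Submfd.IsNormalFrame (Submfd.localRep m x q) (Submfd.coord m q) (ν q)) ∧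
        ContMDiffOn (𝓡 m) 𝓘(ℝ, ℂ) ∞ ζ U ∧
        (∀ q ∈ U, Function.Surjective (mfderiv (𝓡 m) 𝓘(ℝ, ℂ) ζ q)) ∧
        ζ '' U = V ∧ IsOpen V ∧ DifferentiableOn ℂ F V ∧
        (∀ w ∈ V, deriv F w ≠ 0 ∧ ∑ j, (deriv F w j) ^ 2 = 0) ∧
        ∀ q ∈ U, F (ζ q) = Submfd.complexCenter m x q (ν q) ∧
          Submfd.IsMeanCurvatureCenter m x q (WithLp.toLp 2 fun j => (F (ζ q) j).re)) := by
  have key := Submfd.exists_isotropic_curve hm hx humb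
  refine ⟨?_, fun p hp => ?_⟩
  · choose! U ν ζ V F hVb hU hpU hν hνn hζ hζs hζV hV hF hF' hFc using key
    set D := {p : M // Submfd.meanCurvature m x p ≠ 0}
    -- Second countability (Lindelöf): countably many of the neighbourhoods cover the points with H
    -- ≠ 0. This makes S second countable and lets the discs be indexed by integers.
    obtain ⟨T, hTc, hTU⟩ := TopologicalSpace.isOpen_iUnion_countable (fun p : D => U p)
      fun p => hU p p.2
    have := hTc.to_subtype
    obtain ⟨a, G, W, hW, hG, hGW, haW⟩ := Submfd.exists_disjoint_translates
      (fun i : T => V i) (fun i : T => F i) (fun i => hV _ i.1.2) (fun i => hVb _ i.1.2)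
      fun i => hF _ i.1.2
    have hcover : ∀ p, Submfd.meanCurvature m x p ≠ 0 → ∃ i : T, p ∈ U i := by
      intro p hp
      have h1 : p ∈ ⋃ i : D, U i := Set.mem_iUnion.mpr ⟨⟨p, hp⟩, hpU p hp⟩
      rw [← hTU] at h1
      obtain ⟨i, hi, hpi⟩ := Set.mem_iUnion₂.mp h1
      exact ⟨⟨i, hi⟩, hpi⟩
    have hmem : ∀ (i : T), ∀ q ∈ U i, Submfd.planeEquiv.symm (ζ i q + a i) ∈
        Submfd.planeOpens hW := by
      intro i q hq
      change Submfd.planeEquiv (Submfd.planeEquiv.symm _) ∈ W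
      rw [ContinuousLinearEquiv.apply_symm_apply]
      refine (haW i _ ?_).1
      rw [← hζV i i.1.2]
      exact ⟨q, hq, rfl⟩
    have hval : ∀ (i : T), ∀ q ∈ U i, Submfd.realSurface G
        (Submfd.planeEquiv.symm (ζ i q + a i)) = Submfd.rePart (F i (ζ i q)) := by
      intro i q hq
      rw [Submfd.realSurface, ContinuousLinearEquiv.apply_symm_apply, (haW i _ _).2]
      rw [← hζV i i.1.2]
      exact ⟨q, hq, rfl⟩
    refine ⟨Submfd.planeOpens hW, inferInstance, inferInstance,
      fun s => Submfd.realSurface G s, inferInstance, inferInstance, inferInstance,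
      Submfd.isMinimalImmersion_realSurface hW hG fun w hw => ?_, ?_, fun p hp => ?_⟩
    · obtain ⟨i, h1, -, h2⟩ := hGW w hw
      rw [h2]
      exact hF' i i.1.2 _ h1
    · ext c
      constructor
      · rintro ⟨s, rfl⟩
        obtain ⟨i, h1, h2, -⟩ := hGW _ s.2
        rw [← hζV i i.1.2] at h1
        obtain ⟨q, hq, hqs⟩ := h1
        refine ⟨q, ?_⟩
        simp only [Submfd.realSurface]
        rw [h2, ← hqs]
        exact (hFc i i.1.2 q hq).2
      · rintro ⟨p, hp⟩
        have hp0 := (Submfd.isMeanCurvatureCenter_iff m x p c).mp hp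
        obtain ⟨i, hi⟩ := hcover p hp0.1
        refine ⟨⟨_, hmem i p hi⟩, ?_⟩
        simp only [hval i p hi]
        -- The center of the mean curvature sphere is unique, by its explicit formula.
        exact ((Submfd.isMeanCurvatureCenter_iff m x p _).mp (hFc i i.1.2 p hi).2).2.trans
          hp0.2.symm
    · obtain ⟨i, hi⟩ := hcover p hp
      classical
      -- Only the values on `U i` matter; elsewhere the image of p is a default.
      set π : M → Submfd.planeOpens hW := fun q =>
        if hq : q ∈ U i then ⟨_, hmem i q hq⟩ else ⟨_, hmem i p hi⟩ with hπ
      have hπv : ∀ q ∈ U i, (π q : Euc 2) = Submfd.planeEquiv.symm (ζ i q + a i) := by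
        intro q hq
        simp only [hπ, dif_pos hq]
      have hUo := hU i i.1.2
      have hζ2 : ∀ q ∈ U i, ContMDiffAt (𝓡 m) 𝓘(ℝ, ℂ) ∞ (ζ i) q := fun q hq =>
        (hζ i i.1.2).contMDiffAt (hUo.mem_nhds hq)
      have hL : ContDiff ℝ ∞ fun w => Submfd.planeEquiv.symm (w + a i) :=
        Submfd.planeEquiv.symm.contDiff.comp (contDiff_id.add contDiff_const)
      have hev : ∀ q ∈ U i, Subtype.val ∘ π =ᶠ[nhds q]
          (fun w => Submfd.planeEquiv.symm (w + a i)) ∘ ζ i := fun q hq => by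
        filter_upwards [hUo.mem_nhds hq] with z hz
        exact hπv z hz
      have hπc : ∀ q ∈ U i, ContMDiffAt (𝓡 m) (𝓡 2) ∞ π q := fun q hq => by
        refine (ContMDiffAt.subtypeVal_comp_iff _ π q).mp ?_
        exact (hL.contDiffAt.contMDiffAt.comp q (hζ2 q hq)).congr_of_eventuallyEq (hev q hq)
      refine ⟨U i, π, hUo, hi, fun q hq => (hπc q hq).contMDiffWithinAt, fun q hq => ?_,
        fun q hq => ?_⟩
      · have h1 := mfderiv_comp q (contMDiff_subtype_val.contMDiffAt.mdifferentiableAt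
          (by simp : (∞ : ℕ∞ω) ≠ 0)) ((hπc q hq).mdifferentiableAt (by simp))
        have h2 := mfderiv_comp q (hL.contDiffAt.contMDiffAt.mdifferentiableAt (by simp))
          ((hζ2 q hq).mdifferentiableAt (by simp))
        have h3 : fderiv ℝ (fun w => Submfd.planeEquiv.symm (w + a i)) (ζ i q) =
            Submfd.planeEquiv.symm := by
          have := (Submfd.planeEquiv.symm : ℂ →L[ℝ] Euc 2).hasFDerivAt.comp (ζ i q)
            ((hasFDerivAt_id (𝕜 := ℝ) (ζ i q)).add_const (a i))
          exact this.fderiv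
        rw [(hev q hq).mfderiv_eq, h2, mfderiv_eq_fderiv, h3] at h1
        -- Composed with the inclusion of S in the plane, π is ζ followed by a translation and a
        -- linear isomorphism, so the composite derivative is onto.
        refine Submfd.surjective_of_surjective_comp (mfderiv (𝓡 2) (𝓡 2)
          (Subtype.val : Submfd.planeOpens hW → Euc 2) (π q)) fun t => ?_
        obtain ⟨u, hu⟩ := hζs i i.1.2 q hq (Submfd.planeEquiv t)
        refine ⟨u, (congrArg (fun L => L u) h1).symm.trans ?_⟩
        exact (congrArg Submfd.planeEquiv.symm hu).trans (Submfd.planeEquiv.symm_apply_apply t)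
      · simp only [hπv q hq, hval i q hq]
        exact (hFc i i.1.2 q hq).2
  · obtain ⟨U, ν, ζ, V, F, -, h⟩ := key p hp
    exact ⟨U, ν, ζ, V, F, h⟩
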